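/- Let $a,b\in\mathbb R$ with $a<b$, let $N\in\mathbb N=\{1,2,\dots\}$, let $a=x_0<x_1<\dots<x_N=b$, and let $f\colon[a,b]\to\mathbb R$ be a continuous function such that $f|_{[x_{i-1},x_i]}$ is affine linear for every $i\in\{1,\dots,N\}$. Let $R_\infty(x)=\max\{x,0\}$, and let $R_r\in C^1(\mathbb R,\mathbb R)$, $r\in\mathbb N$, satisfy for all $x\in\mathbb R$ that $\sup_{r\in\mathbb N}\sup_{y\in[-|x|,|x|]}|(R_r)'(y)|<\infty$ and $$\limsup_{r\to\infty}\bigl(|R_r(x)-R_\infty(x)|+|(R_r)'(x)-\mathbb 1_{(0,\infty)}(x)|\bigr)=0 .$$ Let $p\colon[a,b]\to(0,\infty)$ be Lipschitz continuous. For $h\in\mathbb N$, $r\in\mathbb N\cup\{\infty\}$ and $\theta=(\theta_1,\dots,\theta_{3h+1})\in\mathbb R^{3h+1}$ let $$\mathcal L^h_r(\theta)=\int_a^b\Bigl(f(x)-\theta_{3h+1}-\sum_{j=1}^h\theta_{2h+j}\,R_r(\theta_jx+\theta_{h+j})\Bigr)^2p(x)\,dx .$$ For $h\in\mathbb N$ let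 $\mathcal G^h\colon\mathbb R^{3h+1}\to\mathbb R^{3h+1}$ satisfy $\mathcal G^h(\theta)=\lim_{r\to\infty}(\nabla\mathcal L^h_r)(\theta)$ for every $\theta$ for which this limit exists. Let $(\Omega,\mathcal F,\mathbb P)$ be a probability space, and let $\Theta^{h,k,\gamma}_n\colon\Omega\to\mathbb R^{3h+1}$ and $\mathbf k^{h,k,\gamma}_n\colon\Omega\to\mathbb N$, for $h,k\in\mathbb N$, $\gamma\in\mathbb R$, $n\in\mathbb N_0$, be random variables such that for all $h\in\mathbb N$ and $\gamma\in\mathbb R$ the $\Theta^{h,k,\gamma}_0$, $k\in\mathbb N$, are independent standard normal random vectors, and such that for all $h,k\in\mathbb N$, $\gamma\in\mathbb R$, $n\in\mathbb N_0$ and $\omega\in\Omega$ $$\Theta^{h,k,\gamma}_{n+1}(\omega)=\Theta^{h,k,\gamma}_n(\omega)-\gamma\,\mathcal G^h\bigl(\Theta^{h,k,\gamma}_n(\omega)\bigr)\quad\text{and}\quad \mathbf k^{h,k,\gamma}_n(\omega)\in\operatorname*{arg\,min}_{\ell\in\{1,\dots,k\}}\mathcal L^h_\infty\bigl(\Theta^{h,\ell,\gamma}_n(\omega)\bigr).$$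 Then there exists $g\in(0,\infty)$ such that for all $\gamma\in(0,g]$ $$\liminf_{h\to\infty}\ \liminf_{K\to\infty}\ \mathbb P\Bigl(\limsup_{n\to\infty}\mathcal L^h_\infty\bigl(\Theta^{h,\mathbf k^{h,K,\gamma}_n,\gamma}_n\bigr)=0\Bigr)=1 .$$ -/

import Mathlib

open Filter Topology MeasureTheory ProbabilityTheory
open scoped ENNReal NNReal

namespace ShallowNet

/-- The ReLU activation function. -/
noncomputable def relu (x : ℝ) : ℝ := max x 0

/-- The parameter space `ℝ^(3h+1)`, with the Euclidean structure, of networks with one input neuron,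
`h` hidden neurons and one output neuron. -/
abbrev Param (h : ℕ) : Type := EuclideanSpace ℝ (Fin (3 * h + 1))

variable {h : ℕ}

/-- Weight of the edge from the input to the `j`-th hidden neuron:
the coordinate with zero-based index `j`. -/
def innerWeight (θ : Param h) (j : Fin h) : ℝ := θ ⟨j, by omega⟩

/-- Bias of the `j`-th hidden neuron: the coordinate with zero-based index `h + j`. -/
def innerBias (θ : Param h) (j : Fin h) : ℝ := θ ⟨h + j, by omega⟩

/-- Weight of the edge from the `j`-th hidden neuron to the output:
the coordinate with zero-based index `2 * h + j`. -/
def outerWeight (θ : Param h) (j : Fin h) : ℝ := θ ⟨2 * h + j, by omega⟩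

/-- Bias of the output neuron: the last coordinate. -/
def outerBias (θ : Param h) : ℝ := θ (Fin.last (3 * h))

/-- The function computed by the network with activation `σ` and parameters `θ`. -/
noncomputable def realization (σ : ℝ → ℝ) (θ : Param h) (x : ℝ) : ℝ :=
  outerBias θ + ∑ j : Fin h, outerWeight θ j * σ (innerWeight θ j * x + innerBias θ j)

/-- The `L²`-risk on `[a, b]` with target `f` and unnormalized density `p`
of the network with activation `σ`. -/
noncomputable def risk (a b : ℝ) (f p σ : ℝ → ℝ) (θ : Param h) : ℝ :=
  ∫ x in a..b, (f x - realization σ θ x) ^ 2 * p x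

end ShallowNet

/-! A target with `n + 1` affine pieces is realized exactly by `n + 1` ReLU neurons: one active on
all of `[a, b]`, and one ramp at each inner grid point (`exactParam`). Near that parameter the risk,
although not smooth, behaves like a function with a nondegenerate manifold of minima.

Two estimates give this. The error bound `exists_dist_sq_le_risk` says that the squared distance to
the exact realizers is at most a constant times the risk: on the middle third of each cell the error
is affine, its coefficients are controlled by the risk, and differences between adjacent cells
isolate the single neurons. The expansion `risk_expansion` has a remainder that is quadratic after
integration (`abs_integral_mul_remainder_le`), because a moving kink affects only a short interval.
It also carries the residual as a factor, which is small near an exact fit. Together they give a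
Polyak–Łojasiewicz inequality and a descent inequality, so gradient descent with `γ ≤ g` converges
to risk zero from an open set of initial values (`exists_isOpen_tendsto_risk`).

For larger widths the surplus neurons are started inactive on `[a, b]`. Their inner parameters then
have zero gradient, so they stay inactive and the dynamics reduce to width `n + 1`; this is why `g`
does not depend on the width. The resulting open set has positive Gaussian measure, hence some one
of `K` independent runs starts in it with probability tending to `1`, and the best run has at most
that run's risk. -/

namespace ShallowNet

variable {h : ℕ}

/-! ### Coordinates on the parameter space. -/

/-- The unit vector of the coordinate `innerWeight · j`. -/
noncomputable def innerWeightVec (j : Fin h) : Param h := EuclideanSpace.single ⟨j, by omega⟩ 1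

/-- The unit vector of the coordinate `innerBias · j`. -/
noncomputable def innerBiasVec (j : Fin h) : Param h := EuclideanSpace.single ⟨h + j, by omega⟩ 1

/-- The unit vector of the coordinate `outerWeight · j`. -/
noncomputable def outerWeightVec (j : Fin h) : Param h :=
  EuclideanSpace.single ⟨2 * h + j, by omega⟩ 1

/-- The unit vector of the coordinate `outerBias`. -/
noncomputable def outerBiasVec : Param h := EuclideanSpace.single (Fin.last (3 * h)) 1

/-- The parameter vector with prescribed weights and biases. -/
noncomputable def mkParam (W B V : Fin h → ℝ) (c : ℝ) : Param h :=
  ∑ j, (W j • innerWeightVec j + B j • innerBiasVec j + V j • outerWeightVec j) + c • outerBiasVec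

@[simp] lemma innerWeight_mkParam (W B V : Fin h → ℝ) (c : ℝ) (j : Fin h) :
    innerWeight (mkParam W B V c) j = W j := by
  have h1 : ∀ k : Fin h, ((j : ℕ) = h + k) ↔ False := fun k => by simp; omega
  have h2 : ∀ k : Fin h, ((j : ℕ) = 2 * h + k) ↔ False := fun k => by simp; omega
  have h3 : ((j : ℕ) = 3 * h) ↔ False := by simp; omega
  simp [innerWeight, mkParam, innerWeightVec, innerBiasVec, outerWeightVec, outerBiasVec,
    Fin.ext_iff, h1, h2, h3]
  simp [Pi.single_apply, ← Fin.ext_iff]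

@[simp] lemma innerBias_mkParam (W B V : Fin h → ℝ) (c : ℝ) (j : Fin h) :
    innerBias (mkParam W B V c) j = B j := by
  have h1 : ∀ k : Fin h, (h + (j : ℕ) = k) ↔ False := fun k => by simp; omega
  have h2 : ∀ k : Fin h, (h + (j : ℕ) = 2 * h + k) ↔ False := fun k => by simp; omega
  have h3 : (h + (j : ℕ) = 3 * h) ↔ False := by simp; omega
  simp [innerBias, mkParam, innerWeightVec, innerBiasVec, outerWeightVec, outerBiasVec,
    Fin.ext_iff, h1, h2, h3]
  simp [Pi.single_apply, ← Fin.ext_iff]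

@[simp] lemma outerWeight_mkParam (W B V : Fin h → ℝ) (c : ℝ) (j : Fin h) :
    outerWeight (mkParam W B V c) j = V j := by
  have h1 : ∀ k : Fin h, (2 * h + (j : ℕ) = k) ↔ False := fun k => by simp; omega
  have h2 : ∀ k : Fin h, (2 * h + (j : ℕ) = h + k) ↔ False := fun k => by simp; omega
  have h3 : (2 * h + (j : ℕ) = 3 * h) ↔ False := by simp; omega
  simp [outerWeight, mkParam, innerWeightVec, innerBiasVec, outerWeightVec, outerBiasVec,
    Fin.ext_iff, h1, h2, h3]
  simp [Pi.single_apply, ← Fin.ext_iff]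

@[simp] lemma outerBias_mkParam (W B V : Fin h → ℝ) (c : ℝ) :
    outerBias (mkParam W B V c) = c := by
  have h1 : ∀ k : Fin h, (3 * h = (k : ℕ)) ↔ False := fun k => by simp; omega
  have h2 : ∀ k : Fin h, (3 * h = h + (k : ℕ)) ↔ False := fun k => by simp; omega
  have h3 : ∀ k : Fin h, (3 * h = 2 * h + (k : ℕ)) ↔ False := fun k => by simp; omega
  simp [outerBias, mkParam, innerWeightVec, innerBiasVec, outerWeightVec, outerBiasVec,
    Fin.ext_iff, h1, h2, h3]

lemma param_ext {θ η : Param h} (hw : ∀ j, innerWeight θ j = innerWeight η j)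
    (hb : ∀ j, innerBias θ j = innerBias η j) (hv : ∀ j, outerWeight θ j = outerWeight η j)
    (hc : outerBias θ = outerBias η) : θ = η := by
  ext ⟨i, hi⟩
  by_cases h1 : i < h
  · exact hw ⟨i, h1⟩
  by_cases h2 : i < 2 * h
  · have := hb ⟨i - h, by omega⟩
    simp only [innerBias] at this
    convert this using 3 <;> omega
  by_cases h3 : i < 3 * h
  · have := hv ⟨i - 2 * h, by omega⟩
    simp only [outerWeight] at this
    convert this using 3 <;> omega
  · have : (⟨i, hi⟩ : Fin (3 * h + 1)) = Fin.last (3 * h) := by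
      ext; simp; omega
    rw [this]; exact hc

lemma mkParam_eta (θ : Param h) :
    mkParam (innerWeight θ) (innerBias θ) (outerWeight θ) (outerBias θ) = θ := by
  apply param_ext <;> simp

@[simp] lemma inner_mkParam (W B V : Fin h → ℝ) (c : ℝ) (δ : Param h) :
    inner ℝ (mkParam W B V c) δ = ∑ j, (W j * innerWeight δ j + B j * innerBias δ j
      + V j * outerWeight δ j) + c * outerBias δ := by
  simp [mkParam, inner_add_left, sum_inner, inner_smul_left, innerWeightVec, innerBiasVec,
    outerWeightVec, outerBiasVec, EuclideanSpace.inner_single_left, innerWeight, innerBias,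
    outerWeight, outerBias]

lemma norm_mkParam_le {W B V : Fin h → ℝ} {c C : ℝ} (hW : ∀ j, |W j| ≤ C) (hB : ∀ j, |B j| ≤ C)
    (hV : ∀ j, |V j| ≤ C) (hc : |c| ≤ C) : ‖mkParam W B V c‖ ≤ (3 * h + 1) * C := by
  have h1 : ∀ j, ‖W j • innerWeightVec j + B j • innerBiasVec j + V j • outerWeightVec j‖
      ≤ 3 * C := fun j => by
    refine (norm_add₃_le).trans ?_
    simp only [norm_smul, innerWeightVec, innerBiasVec, outerWeightVec, PiLp.norm_single,
      Real.norm_eq_abs, norm_one, mul_one]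
    linarith [hW j, hB j, hV j, abs_one (α := ℝ)]
  calc ‖mkParam W B V c‖ ≤ ∑ j : Fin h, 3 * C + C := by
        refine (norm_add_le _ _).trans (add_le_add ((norm_sum_le _ _).trans
          (Finset.sum_le_sum fun j _ => h1 j)) ?_)
        simpa [norm_smul, outerBiasVec] using hc
    _ = _ := by simp; ring

lemma abs_innerWeight_le (θ : Param h) (j : Fin h) : |innerWeight θ j| ≤ ‖θ‖ :=
  PiLp.norm_apply_le θ _

lemma abs_innerBias_le (θ : Param h) (j : Fin h) : |innerBias θ j| ≤ ‖θ‖ :=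
  PiLp.norm_apply_le θ _

lemma abs_outerWeight_le (θ : Param h) (j : Fin h) : |outerWeight θ j| ≤ ‖θ‖ :=
  PiLp.norm_apply_le θ _

lemma abs_outerBias_le (θ : Param h) : |outerBias θ| ≤ ‖θ‖ :=
  PiLp.norm_apply_le θ _

@[simp] lemma innerWeight_sub (θ η : Param h) (j : Fin h) :
    innerWeight (θ - η) j = innerWeight θ j - innerWeight η j := rfl

@[simp] lemma innerBias_sub (θ η : Param h) (j : Fin h) :
    innerBias (θ - η) j = innerBias θ j - innerBias η j := rfl

@[simp] lemma outerWeight_sub (θ η : Param h) (j : Fin h) :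
    outerWeight (θ - η) j = outerWeight θ j - outerWeight η j := rfl

@[simp] lemma outerBias_sub (θ η : Param h) : outerBias (θ - η) = outerBias θ - outerBias η := rfl

@[simp] lemma innerWeight_smul (r : ℝ) (θ : Param h) (j : Fin h) :
    innerWeight (r • θ) j = r * innerWeight θ j := rfl

@[simp] lemma innerBias_smul (r : ℝ) (θ : Param h) (j : Fin h) :
    innerBias (r • θ) j = r * innerBias θ j := rfl

@[simp] lemma outerWeight_smul (r : ℝ) (θ : Param h) (j : Fin h) :
    outerWeight (r • θ) j = r * outerWeight θ j := rfl

@[simp] lemma outerBias_smul (r : ℝ) (θ : Param h) : outerBias (r • θ) = r * outerBias θ := rfl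

@[simp] lemma innerWeight_add (θ η : Param h) (j : Fin h) :
    innerWeight (θ + η) j = innerWeight θ j + innerWeight η j := rfl

@[simp] lemma innerBias_add (θ η : Param h) (j : Fin h) :
    innerBias (θ + η) j = innerBias θ j + innerBias η j := rfl

@[simp] lemma outerWeight_add (θ η : Param h) (j : Fin h) :
    outerWeight (θ + η) j = outerWeight θ j + outerWeight η j := rfl

@[simp] lemma outerBias_add (θ η : Param h) : outerBias (θ + η) = outerBias θ + outerBias η := rfl

lemma hasFDerivAt_innerWeight (j : Fin h) (θ : Param h) :
    HasFDerivAt (fun θ : Param h => innerWeight θ j) (innerSL ℝ (innerWeightVec j)) θ := by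
  convert (innerSL ℝ (innerWeightVec j)).hasFDerivAt (x := θ) using 1
  ext; simp [innerWeightVec, innerWeight, EuclideanSpace.inner_single_left]

lemma hasFDerivAt_innerBias (j : Fin h) (θ : Param h) :
    HasFDerivAt (fun θ : Param h => innerBias θ j) (innerSL ℝ (innerBiasVec j)) θ := by
  convert (innerSL ℝ (innerBiasVec j)).hasFDerivAt (x := θ) using 1
  ext; simp [innerBiasVec, innerBias, EuclideanSpace.inner_single_left]

lemma hasFDerivAt_outerWeight (j : Fin h) (θ : Param h) :
    HasFDerivAt (fun θ : Param h => outerWeight θ j) (innerSL ℝ (outerWeightVec j)) θ := by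
  convert (innerSL ℝ (outerWeightVec j)).hasFDerivAt (x := θ) using 1
  ext; simp [outerWeightVec, outerWeight, EuclideanSpace.inner_single_left]

lemma hasFDerivAt_outerBias (θ : Param h) :
    HasFDerivAt (fun θ : Param h => outerBias θ) (innerSL ℝ outerBiasVec) θ := by
  convert (innerSL ℝ (outerBiasVec (h := h))).hasFDerivAt (x := θ) using 1
  ext; simp [outerBiasVec, outerBias, EuclideanSpace.inner_single_left]

@[fun_prop] lemma continuous_innerWeight (j : Fin h) :
    Continuous (fun θ : Param h => innerWeight θ j) := by unfold innerWeight; fun_prop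

@[fun_prop] lemma continuous_innerBias (j : Fin h) :
    Continuous (fun θ : Param h => innerBias θ j) := by unfold innerBias; fun_prop

@[fun_prop] lemma continuous_outerWeight (j : Fin h) :
    Continuous (fun θ : Param h => outerWeight θ j) := by unfold outerWeight; fun_prop

@[fun_prop] lemma continuous_outerBias :
    Continuous (fun θ : Param h => outerBias θ) := by unfold outerBias; fun_prop

/-! ### Gradients for smooth activations and their ReLU limit. -/

/-- The gradient with respect to the parameters of the realization at the point `x`, for an
activation `σ` with (generalized) derivative `σ'`. -/
noncomputable def paramGradient (σ σ' : ℝ → ℝ) (θ : Param h) (x : ℝ) : Param h :=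
  mkParam (fun j => outerWeight θ j * σ' (innerWeight θ j * x + innerBias θ j) * x)
    (fun j => outerWeight θ j * σ' (innerWeight θ j * x + innerBias θ j))
    (fun j => σ (innerWeight θ j * x + innerBias θ j)) 1

/-- The (generalized) gradient of the risk. -/
noncomputable def riskGradient (a b : ℝ) (f p σ σ' : ℝ → ℝ) (θ : Param h) : Param h :=
  ∫ x in a..b, (2 * (realization σ θ x - f x) * p x) • paramGradient σ σ' θ x

lemma hasFDerivAt_realization {σ : ℝ → ℝ} (hσ : Differentiable ℝ σ) (θ : Param h) (x : ℝ) :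
    HasFDerivAt (fun θ => realization σ θ x) (innerSL ℝ (paramGradient σ (deriv σ) θ x)) θ := by
  unfold realization
  have h1 : ∀ j : Fin h, HasFDerivAt
      (fun θ : Param h => outerWeight θ j * σ (innerWeight θ j * x + innerBias θ j))
      (outerWeight θ j • (deriv σ (innerWeight θ j * x + innerBias θ j) •
        (x • innerSL ℝ (innerWeightVec j) + innerSL ℝ (innerBiasVec j)))
      + σ (innerWeight θ j * x + innerBias θ j) • innerSL ℝ (outerWeightVec j)) θ := fun j =>
    (hasFDerivAt_outerWeight j θ).mul ((hσ _).hasDerivAt.comp_hasFDerivAt θ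
      (((hasFDerivAt_innerWeight j θ).mul_const x).add (hasFDerivAt_innerBias j θ)))
  have h2 := (hasFDerivAt_outerBias θ).add (HasFDerivAt.fun_sum (u := Finset.univ) fun j _ => h1 j)
  refine h2.congr_fderiv ?_
  refine ContinuousLinearMap.ext fun δ => ?_
  simp only [paramGradient, innerSL_apply_apply, inner_mkParam]
  simp [innerWeightVec, innerBiasVec,
    outerWeightVec, outerBiasVec, EuclideanSpace.inner_single_left, innerWeight, innerBias,
    outerWeight, outerBias]
  rw [add_comm]; congr 1
  exact Finset.sum_congr rfl fun j _ => by ring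

/-- The left-continuous Heaviside function, the generalized derivative of `relu`. -/
noncomputable def heaviside (x : ℝ) : ℝ := Set.indicator (Set.Ioi (0 : ℝ)) (fun _ => (1 : ℝ)) x

lemma continuous_realization {σ : ℝ → ℝ} (hσ : Continuous σ) :
    Continuous (fun q : Param h × ℝ => realization σ q.1 q.2) := by
  unfold realization; fun_prop

lemma continuous_paramGradient {σ σ' : ℝ → ℝ} (hσ : Continuous σ) (hσ' : Continuous σ') :
    Continuous (fun q : Param h × ℝ => paramGradient σ σ' q.1 q.2) := by
  unfold paramGradient mkParam; fun_prop

lemma continuous_realization_right {σ : ℝ → ℝ} (hσ : Continuous σ) (θ : Param h) :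
    Continuous (realization σ θ) := by
  unfold realization; fun_prop

lemma continuous_paramGradient_right {σ σ' : ℝ → ℝ} (hσ : Continuous σ) (hσ' : Continuous σ')
    (θ : Param h) : Continuous (paramGradient σ σ' θ) := by
  unfold paramGradient mkParam; fun_prop

/-- Differentiation under the integral: the derivative of the integrand is jointly continuous, hence
bounded on the compact product of the closed unit ball around `θ` and the interval. -/
lemma hasGradientAt_risk {a b : ℝ} {f p σ : ℝ → ℝ} (hf : Continuous f)
    (hp : Continuous p) (hσ : ContDiff ℝ 1 σ) (θ : Param h) :
    HasGradientAt (risk a b f p σ) (riskGradient a b f p σ (deriv σ) θ) θ := by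
  have hσ' : Continuous (deriv σ) := hσ.continuous_deriv le_rfl
  have hr := continuous_realization (h := h) hσ.continuous
  have hg := continuous_paramGradient (h := h) hσ.continuous hσ'
  have hc : Continuous (fun q : Param h × ℝ =>
      (2 * (realization σ q.1 q.2 - f q.2) * p q.2) • paramGradient σ (deriv σ) q.1 q.2) := by
    fun_prop
  have hc' : ∀ η : Param h, Continuous (fun x =>
      (2 * (realization σ η x - f x) * p x) • paramGradient σ (deriv σ) η x) := fun η =>
    hc.comp (continuous_const.prodMk continuous_id)
  have hv : ∀ η : Param h, Continuous (fun x => (f x - realization σ η x) ^ 2 * p x) := fun η => by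
    have : Continuous (realization σ η) := hr.comp (continuous_const.prodMk continuous_id)
    fun_prop
  obtain ⟨C, hC⟩ := ((isCompact_closedBall θ 1).prod (isCompact_uIcc (a := a) (b := b))
    ).exists_bound_of_continuousOn hc.continuousOn
  have key := intervalIntegral.hasFDerivAt_integral_of_dominated_of_fderiv_le (μ := volume)
    (a := a) (b := b)
    (F := fun (η : Param h) x => (f x - realization σ η x) ^ 2 * p x)
    (F' := fun (η : Param h) x => innerSL ℝ
      ((2 * (realization σ η x - f x) * p x) • paramGradient σ (deriv σ) η x))
    (x₀ := θ) (bound := fun _ => C) (Metric.closedBall_mem_nhds θ one_pos)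
    (Eventually.of_forall fun η => (hv η).aestronglyMeasurable)
    ((hv θ).intervalIntegrable _ _)
    (((innerSL ℝ).continuous.comp (hc' θ)).aestronglyMeasurable)
    (ae_of_all _ fun x hx η hη => by
      rw [innerSL_apply_norm]
      exact hC (η, x) ⟨hη, Set.uIoc_subset_uIcc hx⟩)
    intervalIntegrable_const
    (ae_of_all _ fun x _ η _ => by
      have := (((hasFDerivAt_realization (hσ.differentiable one_ne_zero) η x).const_sub
        (f x)).pow 2).mul_const (p x)
      refine this.congr_fderiv ?_
      rw [map_smul]
      refine ContinuousLinearMap.ext fun δ => ?_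
      simp
      ring)
  have e := (innerSL ℝ (E := Param h)).intervalIntegral_comp_comm
    ((hc' θ).intervalIntegrable (μ := volume) a b)
  rw [e] at key
  exact key

lemma abs_mul_add_le {a b x : ℝ} (hx : x ∈ Set.Icc a b) (w c : ℝ) {M : ℝ} (hw : |w| ≤ M)
    (hc : |c| ≤ M) : |w * x + c| ≤ M * (|a| + |b| + 1) := by
  have hx' : |x| ≤ |a| + |b| := (abs_le_max_abs_abs hx.1 hx.2).trans
    (max_le_add_of_nonneg (abs_nonneg _) (abs_nonneg _))
  have hM : 0 ≤ M := (abs_nonneg _).trans hw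
  calc |w * x + c| ≤ |w| * |x| + |c| := (abs_add_le _ _).trans (by rw [abs_mul])
    _ ≤ M * (|a| + |b|) + M := by gcongr
    _ = _ := by ring

/-- Dominated convergence. All preactivations lie in `[-M, M]`, where the derivatives are uniformly
bounded; since `A r 0` converges, the mean value inequality bounds the activations there as well. As
the limit exists at every `θ`, it determines the generalized gradient everywhere. -/
lemma tendsto_riskGradient {a b : ℝ} (hab : a ≤ b) {f p : ℝ → ℝ} (hf : Continuous f)
    (hp : Continuous p) {A : ℕ → ℝ → ℝ} (hA_smooth : ∀ r, ContDiff ℝ 1 (A r))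
    (hA_bound : ∀ x : ℝ, ∃ C : ℝ, ∀ r : ℕ, ∀ y ∈ Set.Icc (-|x|) |x|, |deriv (A r) y| ≤ C)
    (hA : ∀ x, Tendsto (fun r => A r x) atTop (𝓝 (relu x)))
    (hA' : ∀ x, Tendsto (fun r => deriv (A r) x) atTop (𝓝 (heaviside x))) (θ : Param h) :
    Tendsto (fun r => riskGradient a b f p (A r) (deriv (A r)) θ) atTop
      (𝓝 (riskGradient a b f p relu heaviside θ)) := by
  set M := ‖θ‖ * (|a| + |b| + 1) with hM
  have hM0 : 0 ≤ M := by positivity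
  obtain ⟨C₁, hC₁⟩ := hA_bound M
  rw [abs_of_nonneg hM0] at hC₁
  obtain ⟨C₂, hC₂⟩ := (hA 0).abs.bddAbove_range
  have hC₁0 : 0 ≤ C₁ := (abs_nonneg _).trans (hC₁ 0 0 ⟨by linarith, hM0⟩)
  have hAb : ∀ r, ∀ y ∈ Set.Icc (-M) M, |A r y| ≤ C₂ + C₁ * M := fun r y hy => by
    have h1 := (convex_Icc (-M) M).norm_image_sub_le_of_norm_deriv_le
      (fun y _ => (hA_smooth r).differentiable one_ne_zero y) (hC₁ r)
      (x := 0) (y := y) ⟨by linarith, hM0⟩ hy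
    have h2 : |A r 0| ≤ C₂ := hC₂ ⟨r, rfl⟩
    have h3 : |y| ≤ M := abs_le.2 hy
    simp only [Real.norm_eq_abs, sub_zero] at h1
    have h4 := abs_sub_abs_le_abs_sub (A r y) (A r 0)
    nlinarith
  have hy : ∀ x ∈ Set.Icc a b, ∀ j, innerWeight θ j * x + innerBias θ j ∈ Set.Icc (-M) M :=
    fun x hx j => abs_le.1 (abs_mul_add_le hx _ _ (abs_innerWeight_le θ j) (abs_innerBias_le θ j))
  set C := C₂ + C₁ * M with hC
  have hC0 : 0 ≤ C := (abs_nonneg _).trans (hAb 0 0 ⟨by linarith, hM0⟩)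
  -- One bound for all coordinates of `paramGradient`, whatever their block.
  set D := ‖θ‖ * C₁ * (|a| + |b| + 1) + C + 1 with hD
  have hsub : Set.uIoc a b ⊆ Set.Icc a b := by
    rw [Set.uIoc_of_le hab]; exact Set.Ioc_subset_Icc_self
  refine intervalIntegral.tendsto_integral_filter_of_dominated_convergence
    (fun x => (2 * (‖θ‖ + ∑ j : Fin h, ‖θ‖ * C + |f x|) * |p x|) * ((3 * h + 1) * D))
    (Eventually.of_forall fun r => Continuous.aestronglyMeasurable ?_)
    (Eventually.of_forall fun r => ae_of_all _ fun x hx => ?_)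
    (Continuous.intervalIntegrable (by fun_prop) _ _)
    (ae_of_all _ fun x hx => ?_)
  · have h1 : Continuous (realization (A r) θ) :=
      continuous_realization_right (hA_smooth r).continuous θ
    have h2 : Continuous (paramGradient (A r) (deriv (A r)) θ) :=
      continuous_paramGradient_right (hA_smooth r).continuous
        ((hA_smooth r).continuous_deriv le_rfl) θ
    fun_prop
  · have hx := hsub hx
    have hx' : |x| ≤ |a| + |b| := (abs_le_max_abs_abs hx.1 hx.2).trans
      (max_le_add_of_nonneg (abs_nonneg _) (abs_nonneg _))
    have h1 : |realization (A r) θ x| ≤ ‖θ‖ + ∑ j : Fin h, ‖θ‖ * C := by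
      unfold realization
      refine (abs_add_le _ _).trans (add_le_add (abs_outerBias_le θ)
        ((Finset.abs_sum_le_sum_abs _ _).trans (Finset.sum_le_sum fun j _ => ?_)))
      rw [abs_mul]
      exact mul_le_mul (abs_outerWeight_le θ j) (hAb r _ (hy x hx j)) (abs_nonneg _) (norm_nonneg _)
    have hvd : ∀ j, |outerWeight θ j * deriv (A r) (innerWeight θ j * x + innerBias θ j)|
        ≤ ‖θ‖ * C₁ := fun j => by
      rw [abs_mul]
      exact mul_le_mul (abs_outerWeight_le θ j) (hC₁ r _ (hy x hx j)) (abs_nonneg _) (norm_nonneg _)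
    have hT : 0 ≤ ‖θ‖ * C₁ := by positivity
    have ha := abs_nonneg a
    have hb := abs_nonneg b
    rw [norm_smul]
    refine mul_le_mul ?_ (norm_mkParam_le (fun j => ?_) (fun j => ?_) (fun j => ?_) ?_)
      (norm_nonneg _) (by positivity)
    · rw [Real.norm_eq_abs, abs_mul, abs_mul, abs_two]
      gcongr
      exact (abs_sub _ _).trans (add_le_add_left h1 _)
    · rw [abs_mul]
      calc _ ≤ ‖θ‖ * C₁ * (|a| + |b|) := mul_le_mul (hvd j) hx' (abs_nonneg _) hT
        _ ≤ _ := by rw [hD]; nlinarith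
    · refine (hvd j).trans ?_
      rw [hD]; nlinarith [mul_nonneg hT ha, mul_nonneg hT hb]
    · refine (hAb r _ (hy x hx j)).trans ?_
      rw [hD]; nlinarith [mul_nonneg hT ha, mul_nonneg hT hb]
    · rw [abs_one, hD]; nlinarith [mul_nonneg hT ha, mul_nonneg hT hb]
  · refine Tendsto.smul ?_ ?_
    · unfold realization
      refine (Tendsto.const_mul 2 (Tendsto.sub_const ?_ _)).mul_const _
      exact (tendsto_finsetSum _ fun j _ => (hA _).const_mul _).const_add _
    · unfold paramGradient mkParam
      refine Tendsto.add_const _ (tendsto_finsetSum _ fun j _ => ?_)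
      exact ((((hA' _).const_mul _).mul_const _).smul_const _).add
        (((hA' _).const_mul _).smul_const _) |>.add ((hA _).smul_const _)

/-! ### Local convergence of gradient descent. -/

/-- Local convergence of gradient descent to a zero of a nonnegative objective that satisfies a
Polyak–Łojasiewicz inequality and a quadratic upper bound near that zero. -/
theorem exists_isOpen_tendsto_zero_of_polyakLojasiewicz
    {E : Type*} [NormedAddCommGroup E] [InnerProductSpace ℝ E]
    {L : E → ℝ} {G : E → E} {θ₀ : E} {ε c Λ : ℝ} (hε : 0 < ε) (hc : 0 < c) (hΛ : 0 < Λ)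
    (hnonneg : ∀ θ ∈ Metric.ball θ₀ ε, 0 ≤ L θ)
    (hlow : ∀ θ ∈ Metric.ball θ₀ ε, c * L θ ≤ ‖G θ‖ ^ 2)
    (hup : ∀ θ ∈ Metric.ball θ₀ ε, ‖G θ‖ ^ 2 ≤ Λ * L θ)
    (hdesc : ∀ θ ∈ Metric.ball θ₀ ε, ∀ θ' ∈ Metric.ball θ₀ ε,
      L θ' ≤ L θ + inner ℝ (G θ) (θ' - θ) + Λ * ‖θ' - θ‖ ^ 2)
    (hcont : ContinuousAt L θ₀) (hzero : L θ₀ = 0) {γ : ℝ} (hγ : 0 < γ) (hγΛ : 2 * γ * Λ ≤ 1) :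
    ∃ U : Set E, IsOpen U ∧ θ₀ ∈ U ∧ ∀ θ : ℕ → E, θ 0 ∈ U →
      (∀ n, θ (n + 1) = θ n - γ • G (θ n)) → Tendsto (fun n => L (θ n)) atTop (𝓝 0) := by
  -- Shrinking `c` weakens only the lower bound on the gradient; with `c ≤ Λ` one gets `γ * c ≤ 1 /
  -- 2`, hence `ρ > 0`.
  wlog hcΛ : c ≤ Λ generalizing c
  · refine this (c := min c Λ) (lt_min hc hΛ) (fun θ hθ => le_trans ?_ (hlow θ hθ))
      (min_le_right _ _)
    exact mul_le_mul_of_nonneg_right (min_le_left _ _) (hnonneg θ hθ)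
  -- One step multiplies `L` by at most `1 - γ * c / 2 ≤ ρ ^ 2`, so `√L` contracts by the factor
  -- `ρ`.
  set ρ := 1 - γ * c / 4 with hρ
  have hγc : 0 < γ * c := mul_pos hγ hc
  have hγc' : γ * c ≤ 1 / 2 := by nlinarith
  have hρ0 : 0 < ρ := by rw [hρ]; linarith
  have hρ1 : ρ < 1 := by rw [hρ]; linarith
  have hρ2 : 1 - γ * c / 2 ≤ ρ ^ 2 := by rw [hρ]; nlinarith
  set K := γ * √Λ with hK
  have hK0 : 0 < K := mul_pos hγ (Real.sqrt_pos.2 hΛ)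
  -- Step `n` has length at most `K * ρ ^ n * s` with `s = √(L (θ 0))`. For `s < τ` the total `K * s
  -- / (1 - ρ)` is below `ε / 2`, so the iterates never leave the ball.
  set τ := ε * (1 - ρ) / (2 * (K + 1)) with hτ
  have hτ0 : 0 < τ := by
    have : 0 < 1 - ρ := by linarith
    positivity
  have hev : ∀ᶠ θ in 𝓝 θ₀, θ ∈ Metric.ball θ₀ (ε / 2) ∧ L θ < τ ^ 2 :=
    (Filter.eventually_mem_set.2 (Metric.ball_mem_nhds θ₀ (half_pos hε))).and
      (hcont.eventually_lt_const (by rw [hzero]; positivity))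
  obtain ⟨U, hU, hUo, hUm⟩ := mem_nhds_iff.1 hev
  refine ⟨U, hUo, hUm, fun θ h0 hstep => ?_⟩
  obtain ⟨hb0, hL0⟩ := hU h0
  set s := √(L (θ 0)) with hs
  have hs0 : 0 ≤ s := Real.sqrt_nonneg _
  have hsτ : s < τ := by
    rw [hs, Real.sqrt_lt' hτ0]; exact hL0
  have hs2 : s ^ 2 = L (θ 0) :=
    Real.sq_sqrt (hnonneg _ (Metric.ball_subset_ball (by linarith) hb0))
  have hKs : K * s / (1 - ρ) < ε / 2 := by
    rw [div_lt_iff₀ (by linarith)]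
    have : (K + 1) * τ = ε / 2 * (1 - ρ) := by rw [hτ]; field_simp
    nlinarith
  have hball : ∀ n, ‖θ n - θ 0‖ ≤ K * s / (1 - ρ) * (1 - ρ ^ n) → θ n ∈ Metric.ball θ₀ ε := by
    intro n hn
    have h1 : 0 ≤ K * s / (1 - ρ) := div_nonneg (by positivity) (by linarith)
    have h2 : 0 < ρ ^ n := pow_pos hρ0 n
    rw [Metric.mem_ball] at hb0 ⊢
    have h3 := dist_triangle (θ n) (θ 0) θ₀
    rw [dist_eq_norm (θ n) (θ 0)] at h3
    nlinarith
  -- The two claims need each other: the decay is available only inside the ball, and the decay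
  -- keeps the iterates there.
  have main : ∀ n, L (θ n) ≤ (ρ ^ n * s) ^ 2 ∧ ‖θ n - θ 0‖ ≤ K * s / (1 - ρ) * (1 - ρ ^ n) := by
    intro n
    induction n with
    | zero => simp [hs2]
    | succ n ih =>
      obtain ⟨ih1, ih2⟩ := ih
      have hn := hball n ih2
      have hG : ‖G (θ n)‖ ≤ √Λ * (ρ ^ n * s) := by
        refine abs_le_of_sq_le_sq' ?_ (by positivity) |>.2
        rw [mul_pow, Real.sq_sqrt hΛ.le]
        exact (hup _ hn).trans (by gcongr)
      have hd : θ (n + 1) - θ n = -(γ • G (θ n)) := by rw [hstep]; abel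
      have h2 : ‖θ (n + 1) - θ 0‖ ≤ K * s / (1 - ρ) * (1 - ρ ^ (n + 1)) := by
        have h3 : ‖θ (n + 1) - θ n‖ ≤ K * (ρ ^ n * s) := by
          rw [hd, norm_neg, norm_smul, Real.norm_eq_abs, abs_of_pos hγ, hK, mul_assoc]
          gcongr
        have h4 := norm_sub_le_norm_sub_add_norm_sub (θ (n + 1)) (θ n) (θ 0)
        have h5 : K * s / (1 - ρ) * (1 - ρ ^ (n + 1)) =
            K * s / (1 - ρ) * (1 - ρ ^ n) + K * (ρ ^ n * s) := by
          have : 1 - ρ ≠ 0 := by linarith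
          field_simp
          ring
        linarith
      refine ⟨?_, h2⟩
      have hn' := hball _ h2
      have h6 := hdesc _ hn _ hn'
      rw [hd, inner_neg_right, inner_smul_right, real_inner_self_eq_norm_sq, norm_neg, norm_smul,
        Real.norm_eq_abs, abs_of_pos hγ] at h6
      have h7 := hlow _ hn
      have h8 : L (θ (n + 1)) ≤ L (θ n) - γ / 2 * ‖G (θ n)‖ ^ 2 := by
        nlinarith [mul_nonneg hγ.le (sq_nonneg ‖G (θ n)‖)]
      calc L (θ (n + 1)) ≤ (1 - γ * c / 2) * L (θ n) := by nlinarith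
        _ ≤ ρ ^ 2 * L (θ n) := by
          exact mul_le_mul_of_nonneg_right hρ2 (hnonneg _ hn)
        _ ≤ ρ ^ 2 * (ρ ^ n * s) ^ 2 := by gcongr
        _ = _ := by ring
  refine squeeze_zero (fun n => hnonneg _ (hball n (main n).2)) (fun n => (main n).1) ?_
  have := ((tendsto_pow_atTop_nhds_zero_of_lt_one hρ0.le hρ1).mul_const s).pow 2
  simpa using this

/-! ### Pointwise estimates for ReLU and its generalized derivative. -/

lemma continuous_relu : Continuous relu := by unfold relu; fun_prop

lemma abs_relu_le (x : ℝ) : |relu x| ≤ |x| := by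
  unfold relu
  rcases le_total x 0 with hx | hx
  · simp [max_eq_right hx]
  · simp [max_eq_left hx]

lemma abs_relu_sub_relu_le (x y : ℝ) : |relu x - relu y| ≤ |x - y| := by
  simpa [relu] using abs_max_sub_max_le_abs x y 0

lemma heaviside_of_pos {x : ℝ} (hx : 0 < x) : heaviside x = 1 := by simp [heaviside, hx]

lemma heaviside_of_nonpos {x : ℝ} (hx : x ≤ 0) : heaviside x = 0 := by
  simp [heaviside, hx]

lemma measurable_heaviside : Measurable heaviside :=
  measurable_const.indicator measurableSet_Ioi

lemma abs_heaviside_le (x : ℝ) : |heaviside x| ≤ 1 := by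
  rcases lt_or_ge 0 x with hx | hx
  · simp [heaviside_of_pos hx]
  · simp [heaviside_of_nonpos hx]

/-- The first order Taylor remainder of `relu` vanishes unless the kink may have been crossed. -/
lemma abs_relu_remainder_le {x y D : ℝ} (hD : |y - x| ≤ D) :
    |relu y - relu x - heaviside x * (y - x)| ≤ D * (Set.Icc (-D) D).indicator 1 x := by
  have hD0 : 0 ≤ D := (abs_nonneg _).trans hD
  obtain ⟨h1, h2⟩ := abs_le.1 hD
  by_cases hx : x ∈ Set.Icc (-D) D
  · rw [Set.indicator_of_mem hx, Pi.one_apply, mul_one]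
    rcases lt_or_ge 0 x with h0 | h0
    · rw [heaviside_of_pos h0, relu, relu, max_eq_left h0.le]
      rcases le_total y 0 with hy | hy
      · rw [max_eq_right hy, abs_le]; constructor <;> linarith
      · rw [max_eq_left hy, abs_le]; constructor <;> linarith
    · rw [heaviside_of_nonpos h0, relu, relu, max_eq_right h0]
      rcases le_total y 0 with hy | hy
      · rw [max_eq_right hy, abs_le]; constructor <;> linarith
      · rw [max_eq_left hy, abs_le]; constructor <;> linarith
  · rw [Set.indicator_of_notMem hx, mul_zero]
    simp only [Set.mem_Icc, not_and_or, not_le] at hx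
    rcases hx with hx | hx
    · rw [heaviside_of_nonpos (by linarith), relu, relu, max_eq_right (by linarith),
        max_eq_right (by linarith)]
      simp
    · rw [heaviside_of_pos (by linarith), relu, relu, max_eq_left (by linarith),
        max_eq_left (by linarith)]
      simp

lemma intervalIntegrable_paramGradient (a b : ℝ) (θ : Param h) :
    IntervalIntegrable (paramGradient relu heaviside θ) volume a b := by
  have h1 : ∀ j : Fin h, IntervalIntegrable
      (fun x => heaviside (innerWeight θ j * x + innerBias θ j)) volume a b := fun j =>
    (intervalIntegrable_const (c := (1 : ℝ))).mono_fun
      (measurable_heaviside.comp (by fun_prop)).aestronglyMeasurable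
      (ae_of_all _ fun x => by simpa using abs_heaviside_le _)
  have h2 : ∀ {g : ℝ → ℝ} (v : Param h), IntervalIntegrable g volume a b →
      IntervalIntegrable (fun x => g x • v) volume a b := fun v hg =>
    ⟨hg.1.smul_const v, hg.2.smul_const v⟩
  unfold paramGradient mkParam
  refine IntervalIntegrable.add ?_ intervalIntegrable_const
  have : IntervalIntegrable (∑ j, fun x =>
      ((outerWeight θ j * heaviside (innerWeight θ j * x + innerBias θ j) * x) • innerWeightVec j
      + (outerWeight θ j * heaviside (innerWeight θ j * x + innerBias θ j)) • innerBiasVec j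
      + relu (innerWeight θ j * x + innerBias θ j) • outerWeightVec j)) volume a b := by
    refine IntervalIntegrable.sum _ fun j _ => ((h2 _ ?_).add (h2 _ ?_)).add (h2 _ ?_)
    · exact ((h1 j).const_mul _).mul_continuousOn continuousOn_id
    · exact (h1 j).const_mul _
    · exact (continuous_relu.comp (by fun_prop)).intervalIntegrable _ _
  convert this using 1
  ext1 x; simp

/-! ### Expansion of the ReLU risk with an integrated quadratic remainder. -/

section Expansion

variable {a b : ℝ} {f p : ℝ → ℝ}

lemma continuous_realization_relu (θ : Param h) : Continuous (realization relu θ) :=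
  continuous_realization_right continuous_relu θ

/-- The Taylor remainder of the realization in the parameters. -/
noncomputable def remainder (θ η : Param h) (x : ℝ) : ℝ :=
  realization relu η x - realization relu θ x
    - inner ℝ (paramGradient relu heaviside θ x) (η - θ)

lemma intervalIntegrable_smul_paramGradient {g : ℝ → ℝ} (hg : Continuous g) (θ : Param h) :
    IntervalIntegrable (fun x => g x • paramGradient relu heaviside θ x) volume a b :=
  (intervalIntegrable_paramGradient a b θ).continuousOn_smul hg.continuousOn

lemma intervalIntegrable_mul_inner_paramGradient {g : ℝ → ℝ} (hg : Continuous g) (θ δ : Param h) :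
    IntervalIntegrable (fun x => g x * inner ℝ (paramGradient relu heaviside θ x) δ) volume a b := by
  have h1 := intervalIntegrable_smul_paramGradient (a := a) (b := b) hg θ
  have := (⟨h1.1.inner_const (𝕜 := ℝ) δ, h1.2.inner_const (𝕜 := ℝ) δ⟩ : IntervalIntegrable
    (fun x => inner ℝ (g x • paramGradient relu heaviside θ x) δ) volume a b)
  simp only [inner_smul_left, RCLike.conj_to_real] at this
  exact this

lemma inner_riskGradient (hf : Continuous f) (hp : Continuous p) (θ δ : Param h) :
    inner ℝ (riskGradient a b f p relu heaviside θ) δ = ∫ x in a..b,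
      2 * (realization relu θ x - f x) * p x * inner ℝ (paramGradient relu heaviside θ x) δ := by
  have hr := continuous_realization_relu θ
  have h1 := intervalIntegrable_smul_paramGradient (a := a) (b := b)
    (g := fun x => 2 * (realization relu θ x - f x) * p x) (by fun_prop) θ
  have := ((innerSL ℝ).flip δ).intervalIntegral_comp_comm h1
  simp only [ContinuousLinearMap.flip_apply, innerSL_apply_apply, inner_smul_left,
    RCLike.conj_to_real] at this
  exact this.symm

lemma intervalIntegrable_mul_remainder {g : ℝ → ℝ} (hg : Continuous g) (θ η : Param h) :
    IntervalIntegrable (fun x => g x * remainder θ η x) volume a b := by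
  have hr := continuous_realization_relu θ
  have hr' := continuous_realization_relu η
  have h1 : IntervalIntegrable (fun x => g x * (realization relu η x - realization relu θ x))
    volume a b := Continuous.intervalIntegrable (by fun_prop) _ _
  convert h1.sub (intervalIntegrable_mul_inner_paramGradient hg θ (η - θ)) using 1
  ext x; simp [remainder]; ring

/-- Expansion of the risk around `θ`. -/
lemma risk_expansion (hf : Continuous f) (hp : Continuous p) (θ η : Param h) :
    risk a b f p relu η = risk a b f p relu θ
      + inner ℝ (riskGradient a b f p relu heaviside θ) (η - θ)
      + (∫ x in a..b, (realization relu η x - realization relu θ x) ^ 2 * p x)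
      + ∫ x in a..b, 2 * (realization relu θ x - f x) * p x * remainder θ η x := by
  have hr := continuous_realization_relu θ
  have hr' := continuous_realization_relu η
  rw [inner_riskGradient hf hp]
  have hg : Continuous fun x => 2 * (realization relu θ x - f x) * p x := by fun_prop
  have i1 : IntervalIntegrable (fun x => (f x - realization relu θ x) ^ 2 * p x) volume a b :=
    Continuous.intervalIntegrable (by fun_prop) _ _
  have i2 := intervalIntegrable_mul_inner_paramGradient (a := a) (b := b) hg θ (η - θ)
  have i3 : IntervalIntegrable (fun x => (realization relu η x - realization relu θ x) ^ 2 * p x)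
    volume a b := Continuous.intervalIntegrable (by fun_prop) _ _
  have i4 := intervalIntegrable_mul_remainder (a := a) (b := b) hg θ η
  rw [risk, risk, ← intervalIntegral.integral_add i1 i2,
    ← intervalIntegral.integral_add (i1.add i2) i3,
    ← intervalIntegral.integral_add ((i1.add i2).add i3) i4]
  refine intervalIntegral.integral_congr fun x _ => ?_
  simp only [remainder]
  ring

lemma abs_affine_sub_le {x : ℝ} (hx : x ∈ Set.Icc a b) (θ η : Param h) (j : Fin h) :
    |(innerWeight η j * x + innerBias η j) - (innerWeight θ j * x + innerBias θ j)|
      ≤ ‖η - θ‖ * (|a| + |b| + 1) := by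
  have := abs_mul_add_le hx _ _ (abs_innerWeight_le (η - θ) j) (abs_innerBias_le (η - θ) j)
  convert this using 2
  simp; ring

lemma abs_realization_sub_le {x V : ℝ} (hx : x ∈ Set.Icc a b) {θ η : Param h} (hθ : ‖θ‖ ≤ V)
    (hη : ‖η‖ ≤ V) : |realization relu η x - realization relu θ x|
      ≤ (1 + 2 * h * V * (|a| + |b| + 1)) * ‖η - θ‖ := by
  have hR : 0 ≤ |a| + |b| + 1 := by positivity
  have hV : 0 ≤ V := (norm_nonneg _).trans hθ
  have e : realization relu η x - realization relu θ x = outerBias (η - θ)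
      + ∑ j, (outerWeight (η - θ) j * relu (innerWeight η j * x + innerBias η j)
      + outerWeight θ j * (relu (innerWeight η j * x + innerBias η j)
        - relu (innerWeight θ j * x + innerBias θ j))) := by
    simp only [realization, add_sub_add_comm, ← Finset.sum_sub_distrib, outerBias_sub,
      outerWeight_sub]
    congr 1
    exact Finset.sum_congr rfl fun j _ => by ring
  have h1 : ∀ j, |outerWeight (η - θ) j * relu (innerWeight η j * x + innerBias η j)
      + outerWeight θ j * (relu (innerWeight η j * x + innerBias η j)
        - relu (innerWeight θ j * x + innerBias θ j))| ≤ 2 * V * (|a| + |b| + 1) * ‖η - θ‖ := by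
    intro j
    refine (abs_add_le _ _).trans ?_
    rw [abs_mul, abs_mul]
    have h2 : |relu (innerWeight η j * x + innerBias η j)| ≤ V * (|a| + |b| + 1) :=
      (abs_relu_le _).trans (abs_mul_add_le hx _ _ ((abs_innerWeight_le η j).trans hη)
        ((abs_innerBias_le η j).trans hη))
    have h3 := (abs_relu_sub_relu_le _ _).trans (abs_affine_sub_le hx θ η j)
    have h4 := mul_le_mul (abs_outerWeight_le (η - θ) j) h2 (abs_nonneg _) (norm_nonneg _)
    have h5 := mul_le_mul ((abs_outerWeight_le θ j).trans hθ) h3 (abs_nonneg _) hV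
    linarith
  rw [e]
  refine (abs_add_le _ _).trans ?_
  refine (add_le_add (abs_outerBias_le _) ((Finset.abs_sum_le_sum_abs _ _).trans
    (Finset.sum_le_sum fun j _ => h1 j))).trans (le_of_eq ?_)
  simp; ring

/-- Each neuron contributes a product of two increments, which is quadratic, and the Taylor
remainder of ReLU, which is only of first order but vanishes unless the preactivation is within `‖η
- θ‖ * (|a| + |b| + 1)` of the kink. -/
lemma abs_remainder_le {x V : ℝ} (hx : x ∈ Set.Icc a b) {θ : Param h} (hθ : ‖θ‖ ≤ V)
    (η : Param h) : |remainder θ η x| ≤ ∑ j, (‖η - θ‖ ^ 2 * (|a| + |b| + 1)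
      + V * (‖η - θ‖ * (|a| + |b| + 1) *
        (Set.Icc (-(‖η - θ‖ * (|a| + |b| + 1))) (‖η - θ‖ * (|a| + |b| + 1))).indicator 1
          (innerWeight θ j * x + innerBias θ j))) := by
  have hV : 0 ≤ V := (norm_nonneg _).trans hθ
  have e : remainder θ η x = ∑ j, (outerWeight (η - θ) j *
      (relu (innerWeight η j * x + innerBias η j) - relu (innerWeight θ j * x + innerBias θ j))
      + outerWeight θ j * (relu (innerWeight η j * x + innerBias η j)
        - relu (innerWeight θ j * x + innerBias θ j)
        - heaviside (innerWeight θ j * x + innerBias θ j) *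
          ((innerWeight η j * x + innerBias η j) - (innerWeight θ j * x + innerBias θ j)))) := by
    simp only [remainder, realization, paramGradient, inner_mkParam, outerBias_sub,
      outerWeight_sub, innerWeight_sub, innerBias_sub]
    rw [one_mul, add_sub_add_comm, add_comm (Finset.sum _ _) (outerBias η - outerBias θ),
      add_sub_add_left_eq_sub, ← Finset.sum_sub_distrib, ← Finset.sum_sub_distrib]
    exact Finset.sum_congr rfl fun j _ => by ring
  rw [e]
  refine (Finset.abs_sum_le_sum_abs _ _).trans (Finset.sum_le_sum fun j _ => ?_)
  refine (abs_add_le _ _).trans ?_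
  rw [abs_mul, abs_mul]
  have h1 := abs_affine_sub_le hx θ η j
  have h3 := (abs_relu_sub_relu_le _ _).trans h1
  have h4 := mul_le_mul (abs_outerWeight_le (η - θ) j) h3 (abs_nonneg _) (norm_nonneg _)
  have h5 := mul_le_mul ((abs_outerWeight_le θ j).trans hθ) (abs_relu_remainder_le h1)
    (abs_nonneg _) hV
  refine (add_le_add h4 h5).trans (le_of_eq ?_)
  ring

/-- The preimage of `[-D, D]` under a map of slope `w` is an interval of length `2 * D / w`. This
supplies the second power of `‖η - θ‖`, provided the inner weights stay away from zero. -/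
lemma integral_indicator_affine_le {w w₀ c D : ℝ} (hab : a ≤ b) (hw₀ : 0 < w₀) (hw : w₀ ≤ w)
    (hD : 0 ≤ D) : IntervalIntegrable
      (fun x => (Set.Icc (-D) D).indicator (1 : ℝ → ℝ) (w * x + c)) volume a b ∧
    ∫ x in a..b, (Set.Icc (-D) D).indicator (1 : ℝ → ℝ) (w * x + c) ≤ 2 * D / w₀ := by
  have hw' : 0 < w := hw₀.trans_le hw
  have e : (fun x => (Set.Icc (-D) D).indicator (1 : ℝ → ℝ) (w * x + c))
      = (Set.Icc ((-D - c) / w) ((D - c) / w)).indicator 1 := by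
    ext x
    simp only [Set.indicator_apply, Set.mem_Icc, div_le_iff₀ hw', le_div_iff₀ hw']
    congr 1
    apply propext
    constructor <;> rintro ⟨h1, h2⟩ <;> constructor <;> linarith
  have hi : Integrable ((Set.Icc ((-D - c) / w) ((D - c) / w)).indicator (1 : ℝ → ℝ)) :=
    (integrable_indicator_iff measurableSet_Icc).2
      (integrableOn_const (by simp) (by simp))
  rw [e]
  refine ⟨hi.intervalIntegrable, ?_⟩
  rw [intervalIntegral.integral_of_le hab]
  refine (setIntegral_le_integral hi (ae_of_all _ fun x =>
    Set.indicator_nonneg (fun _ _ => zero_le_one) x)).trans ?_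
  rw [integral_indicator_one measurableSet_Icc, Measure.real, Real.volume_Icc,
    ENNReal.toReal_ofReal]
  · rw [div_sub_div_same]
    gcongr
    linarith
  · rw [div_sub_div_same]
    exact div_nonneg (by linarith) hw'.le

/-- In mean, the Taylor remainder of the realization is quadratic. -/
lemma abs_integral_mul_remainder_le (hab : a ≤ b) {w₀ V S : ℝ} (hw₀ : 0 < w₀) {θ : Param h}
    (hw : ∀ j, w₀ ≤ innerWeight θ j) (hθ : ‖θ‖ ≤ V) (η : Param h) {g : ℝ → ℝ}
    (hS : ∀ x ∈ Set.Icc a b, |g x| ≤ S) :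
    |∫ x in a..b, g x * remainder θ η x| ≤ S * (h * ((|a| + |b| + 1) * (b - a)
      + 2 * V * (|a| + |b| + 1) ^ 2 / w₀)) * ‖η - θ‖ ^ 2 := by
  have hV : 0 ≤ V := (norm_nonneg _).trans hθ
  have hS0 : 0 ≤ S := (abs_nonneg _).trans (hS a ⟨le_rfl, hab⟩)
  set R := |a| + |b| + 1 with hR
  have hR0 : 0 ≤ R := by positivity
  set δ := ‖η - θ‖ with hδ
  have hδ0 : 0 ≤ δ := norm_nonneg _
  have hi := fun j => integral_indicator_affine_le (c := innerBias θ j) (D := δ * R) hab hw₀ (hw j)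
    (by positivity)
  have hsum : ∀ j ∈ (Finset.univ : Finset (Fin h)), IntervalIntegrable (fun x => δ ^ 2 * R
      + V * (δ * R * (Set.Icc (-(δ * R)) (δ * R)).indicator (1 : ℝ → ℝ)
        (innerWeight θ j * x + innerBias θ j))) volume a b := fun j _ =>
    intervalIntegrable_const.add (((hi j).1.const_mul _).const_mul _)
  have hsum' : IntervalIntegrable (fun x => S * ∑ j, (δ ^ 2 * R
      + V * (δ * R * (Set.Icc (-(δ * R)) (δ * R)).indicator (1 : ℝ → ℝ)
        (innerWeight θ j * x + innerBias θ j)))) volume a b := by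
    refine IntervalIntegrable.const_mul ?_ _
    have := IntervalIntegrable.sum _ hsum
    simpa only [Finset.sum_fn] using this
  have h1 : |∫ x in a..b, g x * remainder θ η x| ≤ ∫ x in a..b, S * ∑ j, (δ ^ 2 * R
      + V * (δ * R * (Set.Icc (-(δ * R)) (δ * R)).indicator (1 : ℝ → ℝ)
        (innerWeight θ j * x + innerBias θ j))) := by
    rw [← Real.norm_eq_abs]
    refine intervalIntegral.norm_integral_le_of_norm_le hab (ae_of_all _ fun x hx => ?_) hsum'
    have hx' := Set.Ioc_subset_Icc_self hx
    rw [Real.norm_eq_abs, abs_mul]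
    exact mul_le_mul (hS x hx') (abs_remainder_le hx' hθ η) (abs_nonneg _) hS0
  refine h1.trans ?_
  rw [intervalIntegral.integral_const_mul, intervalIntegral.integral_finsetSum hsum]
  have h2 : ∀ j ∈ (Finset.univ : Finset (Fin h)), (∫ x in a..b, (δ ^ 2 * R
      + V * (δ * R * (Set.Icc (-(δ * R)) (δ * R)).indicator (1 : ℝ → ℝ)
        (innerWeight θ j * x + innerBias θ j)))) ≤ (R * (b - a) + 2 * V * R ^ 2 / w₀) * δ ^ 2 := by
    intro j _
    rw [intervalIntegral.integral_add intervalIntegrable_const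
      (((hi j).1.const_mul _).const_mul _), intervalIntegral.integral_const, smul_eq_mul,
      intervalIntegral.integral_const_mul, intervalIntegral.integral_const_mul]
    have h3 : V * (δ * R * ∫ x in a..b, (Set.Icc (-(δ * R)) (δ * R)).indicator (1 : ℝ → ℝ)
        (innerWeight θ j * x + innerBias θ j)) ≤ V * (δ * R * (2 * (δ * R) / w₀)) := by
      gcongr
      exact (hi j).2
    refine (add_le_add_right h3 _).trans (le_of_eq ?_)
    field_simp
  refine (mul_le_mul_of_nonneg_left (Finset.sum_le_sum h2) hS0).trans (le_of_eq ?_)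
  simp
  ring

lemma risk_nonneg (hab : a ≤ b) (hp : ∀ x ∈ Set.Icc a b, 0 ≤ p x) (σ : ℝ → ℝ) (θ : Param h) :
    0 ≤ risk a b f p σ θ :=
  intervalIntegral.integral_nonneg hab fun x hx => mul_nonneg (sq_nonneg _) (hp x hx)

lemma norm_paramGradient_le {x V : ℝ} (hx : x ∈ Set.Icc a b) {θ : Param h} (hθ : ‖θ‖ ≤ V) :
    ‖paramGradient relu heaviside θ x‖ ≤ (3 * h + 1) * (V * (|a| + |b| + 1) + 1) := by
  have hx' : |x| ≤ |a| + |b| := (abs_le_max_abs_abs hx.1 hx.2).trans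
    (max_le_add_of_nonneg (abs_nonneg _) (abs_nonneg _))
  have hV : 0 ≤ V := (norm_nonneg _).trans hθ
  have ha := abs_nonneg a
  have hb := abs_nonneg b
  have h1 : ∀ j, |outerWeight θ j * heaviside (innerWeight θ j * x + innerBias θ j)| ≤ V :=
    fun j => by
      rw [abs_mul]
      have := mul_le_mul ((abs_outerWeight_le θ j).trans hθ)
        (abs_heaviside_le (innerWeight θ j * x + innerBias θ j)) (abs_nonneg _) hV
      linarith
  refine norm_mkParam_le (fun j => ?_) (fun j => ?_) (fun j => ?_) ?_
  · rw [abs_mul]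
    have := mul_le_mul (h1 j) hx' (abs_nonneg _) hV
    linarith
  · nlinarith [h1 j, mul_nonneg hV ha, mul_nonneg hV hb]
  · have := (abs_relu_le _).trans (abs_mul_add_le hx _ _ ((abs_innerWeight_le θ j).trans hθ)
        ((abs_innerBias_le θ j).trans hθ))
    linarith
  · rw [abs_one]; nlinarith [mul_nonneg hV ha, mul_nonneg hV hb]

/-- Cauchy–Schwarz in Young form: integrating `(f - realization + t * q) ^ 2 * p ≥ 0`, with `q` the
inner product of `paramGradient` and `G`, bounds `t * ‖G‖ ^ 2` by the risk plus a term of order `t ^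
2 * ‖G‖ ^ 2`. -/
lemma norm_riskGradient_sq_le (hab : a ≤ b) (hf : Continuous f) (hp : Continuous p) {P V : ℝ}
    (hp0 : ∀ x ∈ Set.Icc a b, 0 ≤ p x) (hP : ∀ x ∈ Set.Icc a b, p x ≤ P)
    {θ : Param h} (hθ : ‖θ‖ ≤ V) :
    ‖riskGradient a b f p relu heaviside θ‖ ^ 2 ≤
      4 * (((3 * h + 1) * (V * (|a| + |b| + 1) + 1)) ^ 2 * P * (b - a) + 1)
        * risk a b f p relu θ := by
  set D := (3 * h + 1) * (V * (|a| + |b| + 1) + 1) with hD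
  set Q := D ^ 2 * P * (b - a) + 1 with hQ
  set G := riskGradient a b f p relu heaviside θ with hG
  have hV : 0 ≤ V := (norm_nonneg _).trans hθ
  have hP0 : 0 ≤ P := (hp0 a ⟨le_rfl, hab⟩).trans (hP a ⟨le_rfl, hab⟩)
  have hQ0 : 0 < Q := by
    have : 0 ≤ b - a := by linarith
    positivity
  have hr := continuous_realization_relu θ
  have e : ‖G‖ ^ 2 = ∫ x in a..b, 2 * (realization relu θ x - f x) * p x
      * inner ℝ (paramGradient relu heaviside θ x) G := by
    rw [← real_inner_self_eq_norm_sq, ← inner_riskGradient hf hp]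
  have i1 := intervalIntegrable_mul_inner_paramGradient (a := a) (b := b)
    (g := fun x => 2 * (realization relu θ x - f x) * p x) (by fun_prop) θ G
  have i2 : IntervalIntegrable (fun x => (f x - realization relu θ x) ^ 2 * p x) volume a b :=
    Continuous.intervalIntegrable (by fun_prop) _ _
  -- This makes `t ^ 2 * Q = t / 2`, so half of `t * ‖G‖ ^ 2` absorbs the quadratic term.
  set t := 1 / (2 * Q) with ht
  have h1 : ‖G‖ ^ 2 * t ≤ risk a b f p relu θ + t ^ 2 * (D * ‖G‖) ^ 2 * P * (b - a) := by
    have : t ^ 2 * (D * ‖G‖) ^ 2 * P * (b - a) = ∫ x in a..b, t ^ 2 * (D * ‖G‖) ^ 2 * P := by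
      simp; ring
    rw [e, this, risk, ← intervalIntegral.integral_mul_const,
      ← intervalIntegral.integral_add i2 intervalIntegrable_const]
    refine intervalIntegral.integral_mono_on hab (i1.mul_const _)
      (i2.add intervalIntegrable_const) fun x hx => ?_
    set q := inner ℝ (paramGradient relu heaviside θ x) G with hq
    have hqD : q ^ 2 ≤ (D * ‖G‖) ^ 2 := by
      refine sq_le_sq' ?_ ?_ <;>
      [have h3 := neg_abs_le q; have h3 := le_abs_self q] <;>
      have h4 := abs_real_inner_le_norm (paramGradient relu heaviside θ x) G <;>
      have h5 := mul_le_mul_of_nonneg_right (norm_paramGradient_le hx hθ) (norm_nonneg G) <;>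
      linarith
    have h6 : t ^ 2 * q ^ 2 * p x ≤ t ^ 2 * (D * ‖G‖) ^ 2 * P := by
      have := hP x hx
      have := hp0 x hx
      gcongr
    have h7 := mul_nonneg (sq_nonneg (f x - realization relu θ x + t * q)) (hp0 x hx)
    have h8 : (f x - realization relu θ x + t * q) ^ 2 * p x = (f x - realization relu θ x) ^ 2 * p x
        - 2 * (realization relu θ x - f x) * p x * q * t + t ^ 2 * q ^ 2 * p x := by ring
    linarith
  have h2 : t ^ 2 * (D * ‖G‖) ^ 2 * P * (b - a) ≤ t / 2 * ‖G‖ ^ 2 := by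
    have : t ^ 2 * (D * ‖G‖) ^ 2 * P * (b - a) = t ^ 2 * ‖G‖ ^ 2 * (Q - 1) := by rw [hQ]; ring
    have h3 : t ^ 2 * Q = t / 2 := by rw [ht]; field_simp
    rw [this, show t ^ 2 * ‖G‖ ^ 2 * (Q - 1) = t ^ 2 * Q * ‖G‖ ^ 2 - t ^ 2 * ‖G‖ ^ 2 by ring, h3]
    exact sub_le_self _ (by positivity)
  have h3 : ‖G‖ ^ 2 * t / 2 ≤ risk a b f p relu θ := by linarith
  have h4 : ‖G‖ ^ 2 * t / 2 * (4 * Q) = ‖G‖ ^ 2 := by rw [ht]; field_simp; ring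
  calc ‖G‖ ^ 2 = ‖G‖ ^ 2 * t / 2 * (4 * Q) := h4.symm
    _ ≤ risk a b f p relu θ * (4 * Q) := mul_le_mul_of_nonneg_right h3 (by positivity)
    _ = _ := mul_comm _ _

end Expansion

/-! ### Sums over kinks and integrals of affine functions. -/

/-- Below, `k.succ ≤ i` expresses that kink `k` does not lie to the right of the left end of cell
`i`. Adjacent cells differ by one kink, so single contributions can be recovered by subtraction. -/
lemma sum_ite_succ_le_succ {n : ℕ} (q : Fin n → ℝ) (j : Fin n) :
    (∑ k : Fin n, if k.succ ≤ j.succ then q k else 0)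
      = (∑ k : Fin n, if k.succ ≤ j.castSucc then q k else 0) + q j := by
  have : ∀ k : Fin n, (if k.succ ≤ j.succ then q k else 0)
      = (if k.succ ≤ j.castSucc then q k else 0) + if k = j then q k else 0 := fun k => by
    rcases lt_trichotomy k j with hk | hk | hk
    · have h1 : k.succ ≤ j.castSucc := by
        rw [Fin.le_def]; simp only [Fin.val_succ, Fin.val_castSucc]; omega
      simp [h1, hk.le, hk.ne]
    · subst hk
      have h1 : ¬ k.succ ≤ k.castSucc := by
        rw [Fin.le_def]; simp only [Fin.val_succ, Fin.val_castSucc]; omega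
      simp [h1]
    · have h1 : ¬ k.succ ≤ j.castSucc := by
        rw [Fin.le_def]; simp only [Fin.val_succ, Fin.val_castSucc]; omega
      simp [h1, hk.not_ge, hk.ne']
  simp_rw [this, Finset.sum_add_distrib]
  simp

lemma sum_ite_succ_le_zero {n : ℕ} (q : Fin n → ℝ) :
    (∑ k : Fin n, if k.succ ≤ (0 : Fin (n + 1)) then q k else 0) = 0 := by
  simp

lemma sum_ite_succ_le_sub {n : ℕ} (g : Fin (n + 1) → ℝ) (i : Fin (n + 1)) :
    (∑ k : Fin n, if k.succ ≤ i then g k.succ - g k.castSucc else 0) = g i - g 0 := by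
  induction i using Fin.induction with
  | zero => rw [sum_ite_succ_le_zero]; simp
  | succ i ih => rw [sum_ite_succ_le_succ, ih]; ring

/-- Centred at the midpoint, the cross term vanishes and the value and the slope separate. -/
lemma integral_affine_sq (l r A B : ℝ) : ∫ x in l..r, (A * x + B) ^ 2 =
    (r - l) * (A * ((l + r) / 2) + B) ^ 2 + A ^ 2 * (r - l) ^ 3 / 12 := by
  rw [intervalIntegral.integral_eq_sub_of_hasDerivAt
    (f := fun x => A ^ 2 * x ^ 3 / 3 + A * B * x ^ 2 + B ^ 2 * x)]
  · ring
  · intro x _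
    have h1 := (((hasDerivAt_pow 3 x).const_mul (A ^ 2)).div_const 3).add
      ((hasDerivAt_pow 2 x).const_mul (A * B)) |>.add ((hasDerivAt_id x).const_mul (B ^ 2))
    exact h1.congr_deriv (by norm_num; ring)
  · exact Continuous.intervalIntegrable (by fun_prop) _ _

/-- The coefficients of an affine function are controlled by its mean square. -/
lemma exists_sq_coeff_le_integral_affine_sq {l r : ℝ} (hlr : l < r) : ∃ K : ℝ, 0 < K ∧ ∀ A B : ℝ,
    A ^ 2 ≤ K * ∫ x in l..r, (A * x + B) ^ 2 ∧ B ^ 2 ≤ K * ∫ x in l..r, (A * x + B) ^ 2 := by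
  have hd : 0 < r - l := by linarith
  set d := r - l with hd'
  set m := (l + r) / 2 with hm
  -- With `I` the integral and `T` the value at the midpoint, `A ^ 2 ≤ 12 * I / d ^ 3` and `T ^ 2 ≤
  -- I / d`; then `B = T - A * m` costs `2 * T ^ 2 + 2 * m ^ 2 * A ^ 2`.
  refine ⟨2 / d + 24 * m ^ 2 / d ^ 3 + 12 / d ^ 3, by positivity, fun A B => ?_⟩
  rw [integral_affine_sq, ← hd', ← hm]
  set T := A * m + B with hT
  have e : (2 / d + 24 * m ^ 2 / d ^ 3 + 12 / d ^ 3) * (d * T ^ 2 + A ^ 2 * d ^ 3 / 12)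
      = 2 * T ^ 2 + A ^ 2 * d ^ 2 / 6 + 24 * m ^ 2 / d ^ 2 * T ^ 2 + 2 * m ^ 2 * A ^ 2
        + 12 / d ^ 2 * T ^ 2 + A ^ 2 := by
    field_simp; ring
  rw [e]
  have h1 : 0 ≤ A ^ 2 * d ^ 2 / 6 := by positivity
  have h2 : 0 ≤ 24 * m ^ 2 / d ^ 2 * T ^ 2 := by positivity
  have h3 : 0 ≤ 12 / d ^ 2 * T ^ 2 := by positivity
  have h4 : 0 ≤ 2 * m ^ 2 * A ^ 2 := by positivity
  have h5 : 0 ≤ 2 * T ^ 2 := by positivity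
  have h6 : B ^ 2 ≤ 2 * T ^ 2 + 2 * m ^ 2 * A ^ 2 := by
    have : B = T - A * m := by rw [hT]; ring
    rw [this]; nlinarith [sq_nonneg (T + A * m)]
  constructor
  · linarith
  · linarith [sq_nonneg A]

lemma relu_mul_of_nonneg {w : ℝ} (hw : 0 ≤ w) (x : ℝ) : relu (w * x) = w * relu x := by
  unfold relu
  rw [mul_max_of_nonneg _ _ hw, mul_zero]

lemma exists_mem_cell_of_mem_Icc {n : ℕ} (grid : Fin (n + 2) → ℝ) {x : ℝ}
    (hx : x ∈ Set.Icc (grid 0) (grid (Fin.last (n + 1)))) :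
    ∃ i : Fin (n + 1), x ∈ Set.Icc (grid i.castSucc) (grid i.succ) := by
  by_contra! hcon
  have : ∀ i : Fin (n + 2), grid i ≤ x := fun i => by
    induction i using Fin.induction with
    | zero => exact hx.1
    | succ i ih =>
      by_contra! hlt
      exact hcon i ⟨ih, hlt.le⟩
  refine hcon (Fin.last n) ⟨this _, ?_⟩
  rw [Fin.succ_last]; exact hx.2

/-! ### Piecewise affine targets and their exact realization. -/

/-- A piecewise affine target: the affine pieces are `α i * x + β i` on the grid cells. -/
structure IsPiecewiseAffine {n : ℕ} (f : ℝ → ℝ) (grid : Fin (n + 2) → ℝ) (α β : Fin (n + 1) → ℝ) :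
    Prop where
  strictMono : StrictMono grid
  eq_affine : ∀ i : Fin (n + 1), ∀ x ∈ Set.Icc (grid i.castSucc) (grid i.succ),
    f x = α i * x + β i

namespace IsPiecewiseAffine

variable {n : ℕ} {f : ℝ → ℝ} {grid : Fin (n + 2) → ℝ} {α β : Fin (n + 1) → ℝ}

lemma lt_cell (H : IsPiecewiseAffine f grid α β) (i : Fin (n + 1)) :
    grid i.castSucc < grid i.succ := H.strictMono Fin.castSucc_lt_succ

/-- The pieces agree at the inner grid points. -/
lemma piece_eq (H : IsPiecewiseAffine f grid α β) (k : Fin n) :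
    α k.castSucc * grid k.succ.castSucc + β k.castSucc
      = α k.succ * grid k.succ.castSucc + β k.succ := by
  rw [← H.eq_affine k.succ _ ⟨le_rfl, (H.lt_cell _).le⟩,
    ← H.eq_affine k.castSucc _ ⟨by rw [← Fin.succ_castSucc]; exact (H.lt_cell _).le,
      by rw [Fin.succ_castSucc]⟩]

lemma grid_le_of_succ_le (H : IsPiecewiseAffine f grid α β) {k : Fin n} {i : Fin (n + 1)}
    (hk : k.succ ≤ i) : grid k.succ.castSucc ≤ grid i.castSucc :=
  H.strictMono.monotone (Fin.castSucc_le_castSucc_iff.2 hk)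

lemma grid_le_of_not_succ_le (H : IsPiecewiseAffine f grid α β) {k : Fin n} {i : Fin (n + 1)}
    (hk : ¬ k.succ ≤ i) : grid i.succ ≤ grid k.succ.castSucc := by
  refine H.strictMono.monotone ?_
  rw [Fin.le_def] at hk ⊢
  simp only [Fin.val_succ, Fin.val_castSucc] at *
  omega

/-- A piecewise affine function is a sum of ramps. -/
lemma eq_sum_relu (H : IsPiecewiseAffine f grid α β) {x : ℝ}
    (hx : x ∈ Set.Icc (grid 0) (grid (Fin.last (n + 1)))) :
    f x = α 0 * x + β 0 + ∑ k : Fin n,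
      (α k.succ - α k.castSucc) * relu (x - grid k.succ.castSucc) := by
  obtain ⟨i, hi⟩ := exists_mem_cell_of_mem_Icc grid hx
  rw [H.eq_affine i x hi]
  -- Piece `i` is piece `0` plus the jumps between successive pieces; by `piece_eq` each jump is the
  -- slope change times the distance to the kink.
  have := sum_ite_succ_le_sub (fun i => α i * x + β i) i
  rw [← sub_eq_iff_eq_add', ← this]
  refine Finset.sum_congr rfl fun k _ => ?_
  split_ifs with hk
  · rw [relu, max_eq_left (by linarith [hi.1, H.grid_le_of_succ_le hk])]
    linarith [H.piece_eq k]
  · rw [relu, max_eq_right (by linarith [hi.2, H.grid_le_of_not_succ_le hk])]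
    simp

/-- Parameters whose neurons sit at the kinks of a piecewise affine target realize it. -/
lemma realization_eq (H : IsPiecewiseAffine f grid α β) {θ : Param (n + 1)}
    (hw : ∀ j, 0 < innerWeight θ j)
    (h0 : 0 ≤ innerWeight θ 0 * grid 0 + innerBias θ 0)
    (hv0 : outerWeight θ 0 * innerWeight θ 0 = α 0)
    (hc : outerBias θ + outerWeight θ 0 * innerBias θ 0 = β 0)
    (hv : ∀ k : Fin n, outerWeight θ k.succ * innerWeight θ k.succ = α k.succ - α k.castSucc)
    (hb : ∀ k : Fin n, α k.succ - α k.castSucc ≠ 0 →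
      innerBias θ k.succ = -(innerWeight θ k.succ * grid k.succ.castSucc))
    {x : ℝ} (hx : x ∈ Set.Icc (grid 0) (grid (Fin.last (n + 1)))) :
    realization relu θ x = f x := by
  rw [H.eq_sum_relu hx, realization, Fin.sum_univ_succ, ← add_assoc]
  congr 1
  · have : 0 ≤ innerWeight θ 0 * x + innerBias θ 0 := by nlinarith [hw 0, hx.1]
    rw [relu, max_eq_left this, ← hv0, ← hc]; ring
  · refine Finset.sum_congr rfl fun k _ => ?_
    -- Where the slope does not change, the outer weight vanishes and the bias is unconstrained.
    by_cases hs : α k.succ - α k.castSucc = 0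
    · have hvk := hv k
      rw [hs, mul_eq_zero, or_iff_left (hw _).ne'] at hvk
      rw [hs, hvk]; simp
    · rw [hb k hs, ← hv k, mul_assoc, ← relu_mul_of_nonneg (hw _).le]
      congr 2; ring

/-- A parameter vector that realizes the target, with one neuron active on the whole interval and
one neuron for every inner grid point. -/
noncomputable def exactParam (grid : Fin (n + 2) → ℝ) (α β : Fin (n + 1) → ℝ) : Param (n + 1) :=
  -- The first preactivation equals `1` at the left endpoint, so that neuron stays active under
  -- small perturbations.
  mkParam (fun _ => 1) (Fin.cons (1 - grid 0) fun k : Fin n => -grid k.succ.castSucc)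
    (Fin.cons (α 0) fun k : Fin n => α k.succ - α k.castSucc) (β 0 - α 0 * (1 - grid 0))

/-- On the middle part of a grid cell, the error of a network whose kinks lie near the inner grid
points is affine. -/
lemma realization_sub_eq (H : IsPiecewiseAffine f grid α β) {θ : Param (n + 1)} {i : Fin (n + 1)}
    {x : ℝ} (hx : x ∈ Set.Icc (grid i.castSucc) (grid i.succ))
    (h0 : 0 ≤ innerWeight θ 0 * x + innerBias θ 0)
    (hpos : ∀ k : Fin n, k.succ ≤ i → 0 ≤ innerWeight θ k.succ * x + innerBias θ k.succ)
    (hneg : ∀ k : Fin n, ¬ k.succ ≤ i → innerWeight θ k.succ * x + innerBias θ k.succ ≤ 0) :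
    realization relu θ x - f x =
      ((outerWeight θ 0 * innerWeight θ 0 - α 0) + ∑ k : Fin n, if k.succ ≤ i then
        outerWeight θ k.succ * innerWeight θ k.succ - (α k.succ - α k.castSucc) else 0) * x
      + ((outerBias θ + outerWeight θ 0 * innerBias θ 0 - β 0) + ∑ k : Fin n, if k.succ ≤ i then
        outerWeight θ k.succ * innerBias θ k.succ
          + (α k.succ - α k.castSucc) * grid k.succ.castSucc else 0) := by
  have hs := sum_ite_succ_le_sub (fun i => α i * x + β i) i
  have e : realization relu θ x = outerBias θ + (outerWeight θ 0 *
      (innerWeight θ 0 * x + innerBias θ 0) + ∑ k : Fin n, if k.succ ≤ i then outerWeight θ k.succ *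
      (innerWeight θ k.succ * x + innerBias θ k.succ) else 0) := by
    rw [realization, Fin.sum_univ_succ]
    congr 2
    · rw [relu, max_eq_left h0]
    · refine Finset.sum_congr rfl fun k _ => ?_
      split_ifs with hk
      · rw [relu, max_eq_left (hpos k hk)]
      · rw [relu, max_eq_right (hneg k hk), mul_zero]
  have e2 : f x = α 0 * x + β 0 + ∑ k : Fin n, if k.succ ≤ i then
      (α k.succ - α k.castSucc) * (x - grid k.succ.castSucc) else 0 := by
    rw [H.eq_affine i x hx, ← sub_eq_iff_eq_add', ← hs]
    refine Finset.sum_congr rfl fun k _ => ?_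
    split_ifs with hk
    · linarith [H.piece_eq k]
    · rfl
  have e3 : (∑ k : Fin n, if k.succ ≤ i then outerWeight θ k.succ *
      (innerWeight θ k.succ * x + innerBias θ k.succ) else 0) - (∑ k : Fin n, if k.succ ≤ i then
      (α k.succ - α k.castSucc) * (x - grid k.succ.castSucc) else 0)
      = (∑ k : Fin n, if k.succ ≤ i then
        outerWeight θ k.succ * innerWeight θ k.succ - (α k.succ - α k.castSucc) else 0) * x
      + ∑ k : Fin n, if k.succ ≤ i then outerWeight θ k.succ * innerBias θ k.succ
          + (α k.succ - α k.castSucc) * grid k.succ.castSucc else 0 := by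
    rw [Finset.sum_mul, ← Finset.sum_add_distrib, ← Finset.sum_sub_distrib]
    refine Finset.sum_congr rfl fun k _ => ?_
    split_ifs <;> ring
  rw [e, e2]
  linarith

end IsPiecewiseAffine

/-! ### The error bound near the exact parameter. -/

lemma norm_param_le {θ : Param h} {C : ℝ} (hw : ∀ j, |innerWeight θ j| ≤ C)
    (hb : ∀ j, |innerBias θ j| ≤ C) (hv : ∀ j, |outerWeight θ j| ≤ C) (hc : |outerBias θ| ≤ C) :
    ‖θ‖ ≤ (3 * h + 1) * C := by
  rw [← mkParam_eta θ]; exact norm_mkParam_le hw hb hv hc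

namespace IsPiecewiseAffine

variable {n : ℕ} {f p : ℝ → ℝ} {grid : Fin (n + 2) → ℝ} {α β : Fin (n + 1) → ℝ}

lemma realization_exactParam (H : IsPiecewiseAffine f grid α β) {x : ℝ}
    (hx : x ∈ Set.Icc (grid 0) (grid (Fin.last (n + 1)))) :
    realization relu (exactParam grid α β) x = f x := by
  apply H.realization_eq _ _ _ _ _ _ hx <;> simp [exactParam]

/-- Near `exactParam`, the weights and biases of the neurons are under control. -/
structure IsNear (grid : Fin (n + 2) → ℝ) (α β : Fin (n + 1) → ℝ) (θ : Param (n + 1)) : Prop where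
  innerWeight_gt : ∀ j, 1 / 2 < innerWeight θ j
  first_pos : 0 < innerWeight θ 0 * grid 0 + innerBias θ 0
  -- Together with `neg`: kinks may move, but not into the middle third of a cell, so the error is
  -- affine there.
  pos : ∀ (i : Fin (n + 1)) (k : Fin n), k.succ ≤ i →
    0 < innerWeight θ k.succ * ((2 * grid i.castSucc + grid i.succ) / 3) + innerBias θ k.succ
  neg : ∀ (i : Fin (n + 1)) (k : Fin n), ¬ k.succ ≤ i →
    innerWeight θ k.succ * ((grid i.castSucc + 2 * grid i.succ) / 3) + innerBias θ k.succ < 0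
  outerWeight_gt : ∀ k : Fin n, α k.succ - α k.castSucc ≠ 0 →
    |α k.succ - α k.castSucc| / 2 < |outerWeight θ k.succ|
  norm_lt : ‖θ‖ < ‖exactParam grid α β‖ + 1

lemma eventually_isNear (H : IsPiecewiseAffine f grid α β) :
    ∀ᶠ θ in 𝓝 (exactParam grid α β), IsNear grid α β θ := by
  have e1 : ∀ᶠ θ in 𝓝 (exactParam grid α β), ∀ j, 1 / 2 < innerWeight θ j :=
    eventually_all.2 fun j => (continuous_innerWeight j).continuousAt.eventually_const_lt
      (by simp [exactParam]; norm_num)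
  have e2 : ∀ᶠ θ in 𝓝 (exactParam grid α β), 0 < innerWeight θ 0 * grid 0 + innerBias θ 0 :=
    (Continuous.continuousAt (by fun_prop)).eventually_const_lt (by simp [exactParam])
  have e3 : ∀ᶠ θ in 𝓝 (exactParam grid α β), ∀ (i : Fin (n + 1)) (k : Fin n), k.succ ≤ i →
      0 < innerWeight θ k.succ * ((2 * grid i.castSucc + grid i.succ) / 3)
        + innerBias θ k.succ :=
    eventually_all.2 fun i => eventually_all.2 fun k => eventually_imp_distrib_left.2 fun hk =>
      (Continuous.continuousAt (by fun_prop)).eventually_const_lt (by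
        have := H.lt_cell i
        have := H.grid_le_of_succ_le hk
        simp only [exactParam, innerWeight_mkParam, innerBias_mkParam, Fin.cons_succ]
        linarith)
  have e4 : ∀ᶠ θ in 𝓝 (exactParam grid α β), ∀ (i : Fin (n + 1)) (k : Fin n), ¬ k.succ ≤ i →
      innerWeight θ k.succ * ((grid i.castSucc + 2 * grid i.succ) / 3)
        + innerBias θ k.succ < 0 :=
    eventually_all.2 fun i => eventually_all.2 fun k => eventually_imp_distrib_left.2 fun hk =>
      (Continuous.continuousAt (by fun_prop)).eventually_lt_const (by
        have := H.lt_cell i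
        have := H.grid_le_of_not_succ_le hk
        simp only [exactParam, innerWeight_mkParam, innerBias_mkParam, Fin.cons_succ]
        linarith)
  have e5 : ∀ᶠ θ in 𝓝 (exactParam grid α β), ∀ k : Fin n, α k.succ - α k.castSucc ≠ 0 →
      |α k.succ - α k.castSucc| / 2 < |outerWeight θ k.succ| :=
    eventually_all.2 fun k => eventually_imp_distrib_left.2 fun hk =>
      (Continuous.continuousAt (by fun_prop)).eventually_const_lt (by
        simp only [exactParam, outerWeight_mkParam, Fin.cons_succ]
        exact half_lt_self (abs_pos.2 hk))
  have e6 : ∀ᶠ θ in 𝓝 (exactParam grid α β), ‖θ‖ < ‖exactParam grid α β‖ + 1 :=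
    continuous_norm.continuousAt.eventually_lt_const (lt_add_one _)
  filter_upwards [e1, e2, e3, e4, e5, e6] with θ h1 h2 h3 h4 h5 h6
  exact ⟨h1, h2, h3, h4, h5, h6⟩

/-- The affine error on the middle of every grid cell has coefficients controlled by the risk. -/
lemma exists_sq_coeff_le_risk (H : IsPiecewiseAffine f grid α β) (hf : Continuous f)
    (hp : Continuous p) (hpos : ∀ x ∈ Set.Icc (grid 0) (grid (Fin.last (n + 1))), 0 < p x) :
    ∃ K : ℝ, 0 < K ∧ ∀ θ : Param (n + 1), IsNear grid α β θ → ∀ i : Fin (n + 1),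
      ((outerWeight θ 0 * innerWeight θ 0 - α 0) + ∑ k : Fin n, if k.succ ≤ i then
        outerWeight θ k.succ * innerWeight θ k.succ - (α k.succ - α k.castSucc) else 0) ^ 2
          ≤ K * risk (grid 0) (grid (Fin.last (n + 1))) f p relu θ ∧
      ((outerBias θ + outerWeight θ 0 * innerBias θ 0 - β 0) + ∑ k : Fin n, if k.succ ≤ i then
        outerWeight θ k.succ * innerBias θ k.succ
          + (α k.succ - α k.castSucc) * grid k.succ.castSucc else 0) ^ 2
          ≤ K * risk (grid 0) (grid (Fin.last (n + 1))) f p relu θ := by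
  have hmono := H.strictMono.monotone
  have h0l : grid 0 ≤ grid (Fin.last (n + 1)) := hmono (Fin.zero_le _)
  -- The positive minimum of `p` compares the weighted with the unweighted integral.
  obtain ⟨x₀, hx₀, hmin⟩ := isCompact_Icc.exists_isMinOn (Set.nonempty_Icc.2 h0l) hp.continuousOn
  have hp₀ := hpos x₀ hx₀
  have hlr : ∀ i : Fin (n + 1), (2 * grid i.castSucc + grid i.succ) / 3
      < (grid i.castSucc + 2 * grid i.succ) / 3 := fun i => by linarith [H.lt_cell i]
  choose K hK hKb using fun i => exists_sq_coeff_le_integral_affine_sq (hlr i)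
  refine ⟨(∑ i, K i) / p x₀, div_pos (Finset.sum_pos (fun i _ => hK i) ⟨0, Finset.mem_univ _⟩) hp₀,
    fun θ hθ i => ?_⟩
  have hKi : K i ≤ ∑ i, K i := Finset.single_le_sum (fun i _ => (hK i).le) (Finset.mem_univ i)
  set A := (outerWeight θ 0 * innerWeight θ 0 - α 0) + ∑ k : Fin n, if k.succ ≤ i then
        outerWeight θ k.succ * innerWeight θ k.succ - (α k.succ - α k.castSucc) else 0 with hA
  set B := (outerBias θ + outerWeight θ 0 * innerBias θ 0 - β 0) + ∑ k : Fin n,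
      if k.succ ≤ i then outerWeight θ k.succ * innerBias θ k.succ
          + (α k.succ - α k.castSucc) * grid k.succ.castSucc else 0 with hB
  set l := (2 * grid i.castSucc + grid i.succ) / 3 with hl
  set r := (grid i.castSucc + 2 * grid i.succ) / 3 with hr
  have hlt := H.lt_cell i
  have hg0 : grid 0 ≤ grid i.castSucc := hmono (Fin.zero_le _)
  have hgl : grid i.succ ≤ grid (Fin.last (n + 1)) := hmono (Fin.le_last _)
  have hw : ∀ j, 0 < innerWeight θ j := fun j => by linarith [hθ.innerWeight_gt j]
  have haff : ∀ x ∈ Set.Icc l r, realization relu θ x - f x = A * x + B := fun x hx => by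
    refine H.realization_sub_eq ⟨by linarith [hx.1], by linarith [hx.2]⟩ ?_ (fun k hk => ?_)
      (fun k hk => ?_)
    · nlinarith [hw 0, hθ.first_pos, hx.1]
    · have := mul_le_mul_of_nonneg_left hx.1 (hw k.succ).le
      have h2 := hθ.pos i k hk
      rw [← hl] at h2
      linarith
    · have := mul_le_mul_of_nonneg_left hx.2 (hw k.succ).le
      have h2 := hθ.neg i k hk
      rw [← hr] at h2
      linarith
  have hrc := continuous_realization_relu θ
  have hint : ∫ x in l..r, (A * x + B) ^ 2
      ≤ risk (grid 0) (grid (Fin.last (n + 1))) f p relu θ / p x₀ := by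
    rw [le_div_iff₀ hp₀, ← intervalIntegral.integral_mul_const]
    have h1 : ∫ x in l..r, (A * x + B) ^ 2 * p x₀
        ≤ ∫ x in l..r, (f x - realization relu θ x) ^ 2 * p x := by
      refine intervalIntegral.integral_mono_on (hlr i).le
        (Continuous.intervalIntegrable (by fun_prop) _ _)
        (Continuous.intervalIntegrable (by fun_prop) _ _) fun x hx => ?_
      rw [← haff x hx, ← neg_sub (f x), neg_sq]
      refine mul_le_mul_of_nonneg_left (hmin ⟨?_, ?_⟩) (sq_nonneg _)
      · linarith [hx.1]
      · linarith [hx.2]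
    refine h1.trans (intervalIntegral.integral_mono_interval (by linarith) (hlr i).le (by linarith)
      ?_ (Continuous.intervalIntegrable (by fun_prop) _ _))
    refine (ae_restrict_iff' measurableSet_Ioc).2 (ae_of_all _ fun x hx => ?_)
    exact mul_nonneg (sq_nonneg _) (hpos x (Set.Ioc_subset_Icc_self hx)).le
  have hint0 : 0 ≤ risk (grid 0) (grid (Fin.last (n + 1))) f p relu θ / p x₀ :=
    div_nonneg (risk_nonneg h0l (fun x hx => (hpos x hx).le) _ _) hp₀.le
  have hfin : K i * ∫ x in l..r, (A * x + B) ^ 2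
      ≤ (∑ i, K i) / p x₀ * risk (grid 0) (grid (Fin.last (n + 1))) f p relu θ := by
    rw [div_mul_eq_mul_div, mul_div_assoc]
    exact (mul_le_mul_of_nonneg_left hint (hK i).le).trans (mul_le_mul_of_nonneg_right hKi hint0)
  exact ⟨(hKb i A B).1.trans hfin, (hKb i A B).2.trans hfin⟩

/-- Near `exactParam`, the squared distance to the parameters that realize the target is controlled
by the risk. -/
lemma exists_dist_sq_le_risk (H : IsPiecewiseAffine f grid α β) (hf : Continuous f)
    (hp : Continuous p) (hpos : ∀ x ∈ Set.Icc (grid 0) (grid (Fin.last (n + 1))), 0 < p x) :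
    ∃ C : ℝ, 0 < C ∧ ∀ θ : Param (n + 1), IsNear grid α β θ → ∃ η : Param (n + 1),
      (∀ x ∈ Set.Icc (grid 0) (grid (Fin.last (n + 1))), realization relu η x = f x) ∧
      ‖η - θ‖ ^ 2 ≤ C * risk (grid 0) (grid (Fin.last (n + 1))) f p relu θ := by
  obtain ⟨K, hK, hKb⟩ := H.exists_sq_coeff_le_risk hf hp hpos
  set s : Fin n → ℝ := fun k => α k.succ - α k.castSucc with hs
  set t : Fin n → ℝ := fun k => grid k.succ.castSucc with ht
  set M := ∑ k, 2 / |s k| with hM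
  have hM0 : 0 ≤ M := Finset.sum_nonneg fun k _ => by positivity
  set T := ∑ k, |t k| with hT
  have hT0 : 0 ≤ T := Finset.sum_nonneg fun k _ => abs_nonneg _
  set B := ‖exactParam grid α β‖ + 1 with hB
  have hB0 : 0 < B := by positivity
  -- The summands serve, in order, the biases at genuine kinks, the outer weights, and (with part of
  -- the `4`) the output bias.
  set D := M * (2 * T + 2) + 4 + 2 * B with hD
  have hD0 : 0 < D := by positivity
  refine ⟨((3 * (n + 1 : ℕ) + 1) * D) ^ 2 * K, by positivity, fun θ hθ => ?_⟩
  set S := risk (grid 0) (grid (Fin.last (n + 1))) f p relu θ with hS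
  have hS0 : 0 ≤ S := risk_nonneg (H.strictMono.monotone (Fin.zero_le _))
    (fun x hx => (hpos x hx).le) _ _
  set τ := √(K * S) with hτ
  have hτ0 : 0 ≤ τ := Real.sqrt_nonneg _
  set w := innerWeight θ with hw'
  set v := outerWeight θ with hv'
  set c := innerBias θ with hc'
  have hw : ∀ j, 1 / 2 < w j := hθ.innerWeight_gt
  have hA : ∀ i : Fin (n + 1), |(v 0 * w 0 - α 0) + ∑ k : Fin n, if k.succ ≤ i then
      v k.succ * w k.succ - s k else 0| ≤ τ := fun i => Real.abs_le_sqrt (hKb θ hθ i).1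
  have hC : ∀ i : Fin (n + 1), |(outerBias θ + v 0 * c 0 - β 0) + ∑ k : Fin n,
      if k.succ ≤ i then v k.succ * c k.succ + s k * t k else 0| ≤ τ :=
    fun i => Real.abs_le_sqrt (hKb θ hθ i).2
  have hp0 : |v 0 * w 0 - α 0| ≤ τ := by
    have := hA 0
    rwa [sum_ite_succ_le_zero, add_zero] at this
  have hq0 : |outerBias θ + v 0 * c 0 - β 0| ≤ τ := by
    have := hC 0
    rwa [sum_ite_succ_le_zero, add_zero] at this
  -- Subtracting the coefficients on the two cells adjacent to a kink isolates its neuron.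
  have hpk : ∀ k, |v k.succ * w k.succ - s k| ≤ 2 * τ := fun k => by
    have h1 := hA k.succ
    rw [sum_ite_succ_le_succ, ← add_assoc] at h1
    have h2 := abs_le.1 (hA k.castSucc)
    have h1 := abs_le.1 h1
    rw [abs_le]; constructor <;> linarith
  have hqk : ∀ k, |v k.succ * c k.succ + s k * t k| ≤ 2 * τ := fun k => by
    have h1 := hC k.succ
    rw [sum_ite_succ_le_succ, ← add_assoc] at h1
    have h2 := abs_le.1 (hC k.castSucc)
    have h1 := abs_le.1 h1
    rw [abs_le]; constructor <;> linarith
  have hdiv : ∀ (j : Fin (n + 1)) {x y : ℝ}, |x| ≤ y → |x / w j| ≤ 2 * y := fun j x y hxy => by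
    rw [abs_div, abs_of_pos (by linarith [hw j] : 0 < w j), div_le_iff₀ (by linarith [hw j])]
    nlinarith [hw j, abs_nonneg x]
  have hw0 : ∀ j, w j ≠ 0 := fun j => by linarith [hw j]
  have hDτ : 4 * τ ≤ D * τ ∧ τ + 2 * B * τ ≤ D * τ ∧ M * (2 * T + 2) * τ ≤ D * τ := by
    have h1 : 0 ≤ M * (2 * T + 2) * τ := by positivity
    have h2 : 0 ≤ 2 * B * τ := by positivity
    rw [hD]
    refine ⟨?_, ?_, ?_⟩ <;> nlinarith
  -- The inner weights are kept and the outer weights solved for. A bias moves only at a genuine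
  -- kink: where `s k = 0` the bias of `θ` may be far from the grid point, but is harmless.
  set η : Param (n + 1) := mkParam w
    (Fin.cons (c 0) fun k => if s k = 0 then c k.succ else -(w k.succ * t k))
    (Fin.cons (α 0 / w 0) fun k => s k / w k.succ) (β 0 - α 0 * c 0 / w 0) with hη
  refine ⟨η, fun x hx => ?_, ?_⟩
  · apply H.realization_eq _ _ _ _ _ _ hx
    · intro j
      simp only [hη, innerWeight_mkParam]; linarith [hw j]
    · simpa [hη] using hθ.first_pos.le
    · simp [hη, hw0]
    · simp only [hη, outerBias_mkParam, outerWeight_mkParam, innerBias_mkParam, Fin.cons_zero]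
      ring
    · intro k
      simp only [hη, outerWeight_mkParam, innerWeight_mkParam, Fin.cons_succ]
      exact div_mul_cancel₀ _ (hw0 _)
    · intro k hk
      simp only [hη, innerBias_mkParam, innerWeight_mkParam, Fin.cons_succ]
      exact if_neg hk
  · have hnorm : ‖η - θ‖ ≤ (3 * (n + 1 : ℕ) + 1) * (D * τ) := by
      refine norm_param_le (fun j => ?_) (fun j => ?_) (fun j => ?_) ?_
      · simp only [hη, innerWeight_sub, innerWeight_mkParam, hw', sub_self, abs_zero]
        positivity
      · simp only [hη, innerBias_sub, innerBias_mkParam]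
        refine Fin.cases ?_ (fun k => ?_) j
        · simp only [hc', Fin.cons_zero, sub_self, abs_zero]; positivity
        · simp only [Fin.cons_succ]
          split_ifs with hk
          · simp only [hc', sub_self, abs_zero]; positivity
          · refine le_trans ?_ hDτ.2.2
            have hv := hθ.outerWeight_gt k hk
            have hsk : 0 < |s k| := abs_pos.2 hk
            have hMk : 2 / |s k| ≤ M :=
              Finset.single_le_sum (f := fun k => 2 / |s k|) (fun k _ => by positivity)
                (Finset.mem_univ k)
            have hTk : |t k| ≤ T :=
              Finset.single_le_sum (f := fun k => |t k|) (fun k _ => abs_nonneg _)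
                (Finset.mem_univ k)
            -- The bias error times the outer weight combines the two coefficient errors; at a
            -- genuine kink the outer weight is bounded below and can be divided out.
            have e : v k.succ * (-(w k.succ * t k) - c k.succ)
                = -(t k * (v k.succ * w k.succ - s k) + (v k.succ * c k.succ + s k * t k)) := by
              ring
            have h1 : |v k.succ| * |-(w k.succ * t k) - c k.succ| ≤ (2 * T + 2) * τ := by
              rw [← abs_mul, e, abs_neg]
              refine (abs_add_le _ _).trans ?_
              rw [abs_mul]
              have := mul_le_mul hTk (hpk k) (abs_nonneg _) hT0
              linarith [hqk k]
            have h2 : |s k| / 2 * |-(w k.succ * t k) - c k.succ| ≤ (2 * T + 2) * τ :=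
              (mul_le_mul_of_nonneg_right hv.le (abs_nonneg _)).trans h1
            calc |-(w k.succ * t k) - c k.succ|
                = 2 / |s k| * (|s k| / 2 * |-(w k.succ * t k) - c k.succ|) := by
                  field_simp
              _ ≤ M * ((2 * T + 2) * τ) := mul_le_mul hMk h2 (by positivity) hM0
              _ = _ := by ring
      · simp only [hη, outerWeight_sub, outerWeight_mkParam]
        refine le_trans ?_ hDτ.1
        refine Fin.cases ?_ (fun k => ?_) j
        · simp only [Fin.cons_zero]
          have e : α 0 / w 0 - v 0 = -((v 0 * w 0 - α 0) / w 0) := by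
            field_simp [hw0 0]; ring
          have := hdiv 0 hp0
          change |α 0 / w 0 - v 0| ≤ _
          rw [e, abs_neg]; linarith
        · simp only [Fin.cons_succ]
          have e : s k / w k.succ - v k.succ = -((v k.succ * w k.succ - s k) / w k.succ) := by
            field_simp [hw0 k.succ]; ring
          have := hdiv k.succ (hpk k)
          change |s k / w k.succ - v k.succ| ≤ _
          rw [e, abs_neg]; linarith
      · simp only [hη, outerBias_sub, outerBias_mkParam]
        refine le_trans ?_ hDτ.2.1
        have e : β 0 - α 0 * c 0 / w 0 - outerBias θ = -(outerBias θ + v 0 * c 0 - β 0)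
            + c 0 * ((v 0 * w 0 - α 0) / w 0) := by
          field_simp [hw0 0]; ring
        rw [e]
        refine (abs_add_le _ _).trans ?_
        rw [abs_neg, abs_mul]
        have h1 : |c 0| ≤ B := (abs_innerBias_le θ 0).trans hθ.norm_lt.le
        have := mul_le_mul h1 (hdiv 0 hp0) (abs_nonneg _) hB0.le
        linarith
    calc ‖η - θ‖ ^ 2 ≤ ((3 * (n + 1 : ℕ) + 1) * (D * τ)) ^ 2 := by gcongr
      _ = ((3 * (n + 1 : ℕ) + 1) * D) ^ 2 * τ ^ 2 := by ring
      _ = _ := by rw [hτ, Real.sq_sqrt (by positivity)]; ring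

variable {n : ℕ} {f p : ℝ → ℝ} {grid : Fin (n + 2) → ℝ} {α β : Fin (n + 1) → ℝ}

/-! ### The Polyak–Łojasiewicz inequality near the exact parameter. -/

/-- Gradient descent with small step size, started near `exactParam`, drives the risk to zero. -/
theorem exists_isOpen_tendsto_risk (H : IsPiecewiseAffine f grid α β) (hf : Continuous f)
    (hp : Continuous p) (hpos : ∀ x ∈ Set.Icc (grid 0) (grid (Fin.last (n + 1))), 0 < p x) :
    ∃ g : ℝ, 0 < g ∧ ∀ γ : ℝ, 0 < γ → γ ≤ g → ∃ U : Set (Param (n + 1)), IsOpen U ∧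
      exactParam grid α β ∈ U ∧ ∀ θ : ℕ → Param (n + 1), θ 0 ∈ U →
      (∀ m, θ (m + 1) = θ m - γ •
        riskGradient (grid 0) (grid (Fin.last (n + 1))) f p relu heaviside (θ m)) →
      Tendsto (fun m => risk (grid 0) (grid (Fin.last (n + 1))) f p relu (θ m)) atTop (𝓝 0) := by
  obtain ⟨C₀, hC₀, herr⟩ := H.exists_dist_sq_le_risk hf hp hpos
  set a := grid 0 with ha
  set b := grid (Fin.last (n + 1)) with hb
  have hab : a ≤ b := H.strictMono.monotone (Fin.zero_le _)
  set θ₀ := exactParam grid α β with hθ₀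
  have hp0 : ∀ x ∈ Set.Icc a b, 0 ≤ p x := fun x hx => (hpos x hx).le
  obtain ⟨P, hP⟩ : ∃ P, ∀ x ∈ Set.Icc a b, p x ≤ P := by
    obtain ⟨P, hP⟩ := isCompact_Icc.exists_bound_of_continuousOn hp.continuousOn
    exact ⟨P, fun x hx => (le_abs_self _).trans (hP x hx)⟩
  have hP0 : 0 ≤ P := (hp0 a ⟨le_rfl, hab⟩).trans (hP a ⟨le_rfl, hab⟩)
  set V := ‖θ₀‖ + 1 with hV
  have hV0 : 0 ≤ V := by positivity
  have hθ₀V : ‖θ₀‖ ≤ V := by linarith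
  have hba : 0 ≤ b - a := by linarith
  set CL := 1 + 2 * (n + 1 : ℕ) * V * (|a| + |b| + 1) with hCL
  have hCL0 : 0 < CL := by positivity
  set Ce := ((n + 1 : ℕ) : ℝ) * ((|a| + |b| + 1) * (b - a)
    + 2 * V * (|a| + |b| + 1) ^ 2 / (1 / 2)) with hCe
  have hCe0 : 0 ≤ Ce := by positivity
  have hfit : ∀ x ∈ Set.Icc a b, realization relu θ₀ x = f x :=
    fun x hx => H.realization_exactParam hx
  -- Since `θ₀` fits exactly, the residual at `θ` is at most `CL * ‖θ - θ₀‖`, an extra small factor.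
  have hrem : ∀ θ, IsNear grid α β θ → ∀ η, |∫ x in a..b,
      2 * (realization relu θ x - f x) * p x * remainder θ η x|
        ≤ 2 * CL * P * Ce * ‖θ - θ₀‖ * ‖η - θ‖ ^ 2 := fun θ hθ η => by
    have h1 : ∀ x ∈ Set.Icc a b, |2 * (realization relu θ x - f x) * p x|
        ≤ 2 * (CL * ‖θ - θ₀‖) * P := fun x hx => by
      rw [abs_mul, abs_mul, abs_two, abs_of_nonneg (hp0 x hx), ← hfit x hx]
      have := abs_realization_sub_le hx hθ₀V hθ.norm_lt.le
      have := hP x hx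
      have := hp0 x hx
      gcongr
    refine (abs_integral_mul_remainder_le hab one_half_pos (fun j => (hθ.innerWeight_gt j).le)
      hθ.norm_lt.le η h1).trans (le_of_eq ?_)
    rw [hCe]; ring
  have hsq : ∀ θ η : Param (n + 1), ‖θ‖ ≤ V → ‖η‖ ≤ V →
      ∫ x in a..b, (realization relu η x - realization relu θ x) ^ 2 * p x
        ≤ CL ^ 2 * P * (b - a) * ‖η - θ‖ ^ 2 := fun θ η hθ hη => by
    have hr := continuous_realization_relu θ
    have hr' := continuous_realization_relu η
    have : CL ^ 2 * P * (b - a) * ‖η - θ‖ ^ 2 = ∫ x in a..b, (CL * ‖η - θ‖) ^ 2 * P := by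
      simp; ring
    rw [this]
    refine intervalIntegral.integral_mono_on hab (Continuous.intervalIntegrable (by fun_prop) _ _)
      intervalIntegrable_const fun x hx => ?_
    have h1 := abs_realization_sub_le hx hθ hη
    exact mul_le_mul (sq_le_sq' (abs_le.1 h1).1 (abs_le.1 h1).2) (hP x hx) (hp0 x hx) (sq_nonneg _)
  set Λ₂ := 4 * (((3 * (n + 1 : ℕ) + 1) * (V * (|a| + |b| + 1) + 1)) ^ 2 * P * (b - a) + 1) with hΛ₂
  have hΛ₂0 : 0 < Λ₂ := by positivity
  set Λ := CL ^ 2 * P * (b - a) + 2 * CL * P * Ce + Λ₂ with hΛ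
  have hΛ0 : 0 < Λ := by positivity
  obtain ⟨ε₀, hε₀, hnear⟩ := Metric.eventually_nhds_iff_ball.1 H.eventually_isNear
  -- The last condition makes the remainder toward a nearby exact realizer at most `L θ`.
  obtain ⟨ε, hε, hεε₀, hε1, hεC⟩ : ∃ ε : ℝ, 0 < ε ∧ ε ≤ ε₀ ∧ ε ≤ 1 ∧
      2 * CL * P * Ce * ε * C₀ ≤ 1 := by
    have hq : 0 ≤ 2 * CL * P * Ce * C₀ := by positivity
    refine ⟨min ε₀ (1 / (2 * CL * P * Ce * C₀ + 1)), lt_min hε₀ (by positivity), min_le_left _ _,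
      (min_le_right _ _).trans ?_, ?_⟩
    · rw [div_le_one (by positivity)]; linarith
    · calc 2 * CL * P * Ce * min ε₀ (1 / (2 * CL * P * Ce * C₀ + 1)) * C₀
          = 2 * CL * P * Ce * C₀ * min ε₀ (1 / (2 * CL * P * Ce * C₀ + 1)) := by ring
        _ ≤ 2 * CL * P * Ce * C₀ * (1 / (2 * CL * P * Ce * C₀ + 1)) :=
          mul_le_mul_of_nonneg_left (min_le_right _ _) hq
        _ ≤ 1 := by rw [mul_one_div, div_le_one (by positivity)]; linarith
  have hN : ∀ θ ∈ Metric.ball θ₀ ε, IsNear grid α β θ := fun θ hθ =>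
    hnear θ (Metric.ball_subset_ball hεε₀ hθ)
  have hdist : ∀ θ ∈ Metric.ball θ₀ ε, ‖θ - θ₀‖ ≤ ε := fun θ hθ => by
    rw [← dist_eq_norm]; exact (Metric.mem_ball.1 hθ).le
  set L := risk a b f p relu (h := n + 1) with hL
  set G := riskGradient a b f p relu heaviside (h := n + 1) with hG
  have hL0 : ∀ θ, 0 ≤ L θ := fun θ => risk_nonneg hab hp0 _ _
  have hLθ₀ : L θ₀ = 0 := by
    rw [hL, risk]
    rw [intervalIntegral.integral_congr (g := fun _ => 0)]
    · simp
    · intro x hx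
      rw [Set.uIcc_of_le hab] at hx
      simp [hfit x hx]
  -- Expand toward the exact realizer `η` of the error bound. Its quadratic term is `L θ` itself, so
  -- `0 = 2 * L θ + ⟪G θ, η - θ⟫ +` remainder. Hence `L θ ≤ ‖G θ‖ * ‖η - θ‖`, and `‖η - θ‖ ^ 2 ≤ C₀
  -- * L θ`.
  have hlow : ∀ θ ∈ Metric.ball θ₀ ε, 1 / C₀ * L θ ≤ ‖G θ‖ ^ 2 := fun θ hθ => by
    obtain ⟨η, hη, hηd⟩ := herr θ (hN θ hθ)
    have hLη : L η = 0 := by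
      rw [hL, risk]
      rw [intervalIntegral.integral_congr (g := fun _ => 0)]
      · simp
      · intro x hx
        rw [Set.uIcc_of_le hab] at hx
        simp [hη x hx]
    have hLθ : ∫ x in a..b, (realization relu η x - realization relu θ x) ^ 2 * p x = L θ := by
      refine intervalIntegral.integral_congr fun x hx => ?_
      rw [Set.uIcc_of_le hab] at hx
      simp only [hη x hx]
    have hexp := risk_expansion (a := a) (b := b) hf hp θ η
    rw [hLθ] at hexp
    change L η = L θ + inner ℝ (G θ) (η - θ) + L θ + _ at hexp
    have h1 := (abs_le.1 (hrem θ (hN θ hθ) η)).1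
    have h2 : 2 * CL * P * Ce * ‖θ - θ₀‖ * ‖η - θ‖ ^ 2 ≤ L θ := by
      have hd := hdist θ hθ
      calc 2 * CL * P * Ce * ‖θ - θ₀‖ * ‖η - θ‖ ^ 2
          ≤ 2 * CL * P * Ce * ε * (C₀ * L θ) := by gcongr
        _ = 2 * CL * P * Ce * ε * C₀ * L θ := by ring
        _ ≤ 1 * L θ := mul_le_mul_of_nonneg_right hεC (hL0 θ)
        _ = L θ := one_mul _
    have h3 := (abs_le.1 (abs_real_inner_le_norm (G θ) (η - θ))).1
    have h4 : L θ ≤ ‖G θ‖ * ‖η - θ‖ := by linarith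
    have h5 : L θ ^ 2 ≤ ‖G θ‖ ^ 2 * (C₀ * L θ) := by
      calc L θ ^ 2 ≤ (‖G θ‖ * ‖η - θ‖) ^ 2 := pow_le_pow_left₀ (hL0 θ) h4 2
        _ = ‖G θ‖ ^ 2 * ‖η - θ‖ ^ 2 := by ring
        _ ≤ _ := mul_le_mul_of_nonneg_left hηd (sq_nonneg _)
    rw [one_div, inv_mul_le_iff₀ hC₀]
    rcases (hL0 θ).eq_or_lt with h0 | h0
    · rw [← h0]; positivity
    · refine le_of_mul_le_mul_right ?_ h0
      linarith
  have hup : ∀ θ ∈ Metric.ball θ₀ ε, ‖G θ‖ ^ 2 ≤ Λ * L θ := fun θ hθ => by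
    refine (norm_riskGradient_sq_le hab hf hp hp0 hP (hN θ hθ).norm_lt.le).trans ?_
    refine mul_le_mul_of_nonneg_right ?_ (hL0 θ)
    rw [hΛ]
    refine le_add_of_nonneg_left (by positivity)
  have hdesc : ∀ θ ∈ Metric.ball θ₀ ε, ∀ η ∈ Metric.ball θ₀ ε,
      L η ≤ L θ + inner ℝ (G θ) (η - θ) + Λ * ‖η - θ‖ ^ 2 := fun θ hθ η hη => by
    have hexp := risk_expansion (a := a) (b := b) hf hp θ η
    change L η = L θ + inner ℝ (G θ) (η - θ) + _ + _ at hexp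
    have h1 := (abs_le.1 (hrem θ (hN θ hθ) η)).2
    have h2 := hsq θ η (hN θ hθ).norm_lt.le (hN η hη).norm_lt.le
    have h3 : 2 * CL * P * Ce * ‖θ - θ₀‖ * ‖η - θ‖ ^ 2 ≤ 2 * CL * P * Ce * ‖η - θ‖ ^ 2 := by
      have hd := (hdist θ hθ).trans hε1
      calc 2 * CL * P * Ce * ‖θ - θ₀‖ * ‖η - θ‖ ^ 2
          ≤ 2 * CL * P * Ce * 1 * ‖η - θ‖ ^ 2 := by gcongr
        _ = _ := by rw [mul_one]
    have h4 : 0 ≤ Λ₂ * ‖η - θ‖ ^ 2 := by positivity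
    rw [hexp, hΛ, add_mul, add_mul]
    linarith
  have hcont : ContinuousAt L θ₀ := by
    rw [ContinuousAt, hLθ₀]
    have hlim : Tendsto (fun η => L θ₀ + inner ℝ (G θ₀) (η - θ₀) + Λ * ‖η - θ₀‖ ^ 2) (𝓝 θ₀)
        (𝓝 0) := by
      have : Continuous fun η => L θ₀ + inner ℝ (G θ₀) (η - θ₀) + Λ * ‖η - θ₀‖ ^ 2 := by fun_prop
      simpa [hLθ₀] using this.tendsto θ₀
    refine tendsto_of_tendsto_of_tendsto_of_le_of_le' tendsto_const_nhds hlim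
      (Eventually.of_forall hL0) ?_
    filter_upwards [Metric.ball_mem_nhds θ₀ hε] with η hη
    exact hdesc θ₀ (Metric.mem_ball_self hε) η hη
  refine ⟨1 / (2 * Λ), by positivity, fun γ hγ hγg => ?_⟩
  refine exists_isOpen_tendsto_zero_of_polyakLojasiewicz hε (by positivity : 0 < 1 / C₀) hΛ0
    (fun θ _ => hL0 θ) hlow hup hdesc hcont hLθ₀ hγ ?_
  rw [le_div_iff₀ (by positivity)] at hγg
  linarith

end IsPiecewiseAffine

/-! ### Surplus neurons that are inactive on the interval. -/

section Restriction

variable {m k : ℕ}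

/-- Forget all but the first `m` hidden neurons. -/
noncomputable def restrictParam (m k : ℕ) : Param (m + k) →L[ℝ] Param m :=
  LinearMap.toContinuousLinearMap
    { toFun := fun θ => mkParam (fun j => innerWeight θ (Fin.castAdd k j))
        (fun j => innerBias θ (Fin.castAdd k j)) (fun j => outerWeight θ (Fin.castAdd k j))
        (outerBias θ)
      map_add' := fun θ η => by apply param_ext <;> simp
      map_smul' := fun r θ => by apply param_ext <;> simp }

@[simp] lemma innerWeight_restrictParam (θ : Param (m + k)) (j : Fin m) :
    innerWeight (restrictParam m k θ) j = innerWeight θ (Fin.castAdd k j) := by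
  simp [restrictParam]

@[simp] lemma innerBias_restrictParam (θ : Param (m + k)) (j : Fin m) :
    innerBias (restrictParam m k θ) j = innerBias θ (Fin.castAdd k j) := by
  simp [restrictParam]

@[simp] lemma outerWeight_restrictParam (θ : Param (m + k)) (j : Fin m) :
    outerWeight (restrictParam m k θ) j = outerWeight θ (Fin.castAdd k j) := by
  simp [restrictParam]

@[simp] lemma outerBias_restrictParam (θ : Param (m + k)) :
    outerBias (restrictParam m k θ) = outerBias θ := by
  simp [restrictParam]

/-- The neurons after the first `m` ones are inactive on `[a, b]`. -/
def IsInactiveAfter (a b : ℝ) (m k : ℕ) (θ : Param (m + k)) : Prop :=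
  ∀ j : Fin k, innerWeight θ (Fin.natAdd m j) * a + innerBias θ (Fin.natAdd m j) < 0 ∧
    innerWeight θ (Fin.natAdd m j) * b + innerBias θ (Fin.natAdd m j) < 0

variable {a b : ℝ} {f p : ℝ → ℝ}

lemma IsInactiveAfter.nonpos {θ : Param (m + k)} (hθ : IsInactiveAfter a b m k θ) {x : ℝ}
    (hx : x ∈ Set.Icc a b) (j : Fin k) :
    innerWeight θ (Fin.natAdd m j) * x + innerBias θ (Fin.natAdd m j) ≤ 0 := by
  obtain ⟨h1, h2⟩ := hθ j
  rcases le_total 0 (innerWeight θ (Fin.natAdd m j)) with hw | hw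
  · linarith [mul_le_mul_of_nonneg_left hx.2 hw]
  · linarith [mul_le_mul_of_nonpos_left hx.1 hw]

lemma isOpen_setOf_isInactiveAfter : IsOpen {θ | IsInactiveAfter a b m k θ} := by
  simp only [IsInactiveAfter, Set.ofPred_forall, Set.ofPred_and]
  exact isOpen_iInter_of_finite fun j =>
    (isOpen_lt (by fun_prop) continuous_const).inter (isOpen_lt (by fun_prop) continuous_const)

lemma IsInactiveAfter.realization_restrictParam {θ : Param (m + k)}
    (hθ : IsInactiveAfter a b m k θ) {x : ℝ} (hx : x ∈ Set.Icc a b) :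
    realization relu (restrictParam m k θ) x = realization relu θ x := by
  have h : ∀ j : Fin k, relu (innerWeight θ (Fin.natAdd m j) * x + innerBias θ (Fin.natAdd m j))
      = 0 := fun j => by rw [relu, max_eq_right (hθ.nonpos hx j)]
  simp only [realization, Fin.sum_univ_add, h, outerBias_restrictParam, outerWeight_restrictParam,
    innerWeight_restrictParam, innerBias_restrictParam]
  simp

lemma IsInactiveAfter.risk_restrictParam (hab : a ≤ b) {θ : Param (m + k)}
    (hθ : IsInactiveAfter a b m k θ) :
    risk a b f p relu (restrictParam m k θ) = risk a b f p relu θ := by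
  refine intervalIntegral.integral_congr fun x hx => ?_
  rw [Set.uIcc_of_le hab] at hx
  simp only [hθ.realization_restrictParam hx]

lemma restrictParam_paramGradient (σ σ' : ℝ → ℝ) (θ : Param (m + k)) (x : ℝ) :
    restrictParam m k (paramGradient σ σ' θ x) = paramGradient σ σ' (restrictParam m k θ) x := by
  apply param_ext <;> simp [paramGradient]

/-- Restriction is linear and commutes with the integral; the residual is the same because inactive
neurons output zero. -/
lemma IsInactiveAfter.riskGradient_restrictParam (hab : a ≤ b) (hf : Continuous f)
    (hp : Continuous p) {θ : Param (m + k)} (hθ : IsInactiveAfter a b m k θ) :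
    riskGradient a b f p relu heaviside (restrictParam m k θ)
      = restrictParam m k (riskGradient a b f p relu heaviside θ) := by
  have hr := continuous_realization_relu θ
  rw [riskGradient, riskGradient, ← ContinuousLinearMap.intervalIntegral_comp_comm _
    (intervalIntegrable_smul_paramGradient (by fun_prop) θ)]
  refine intervalIntegral.integral_congr fun x hx => ?_
  rw [Set.uIcc_of_le hab] at hx
  simp only [hθ.realization_restrictParam hx, map_smul, restrictParam_paramGradient]

lemma inner_riskGradient_eq_zero (hab : a ≤ b) (hf : Continuous f) (hp : Continuous p)
    {θ δ : Param h} (hδ : ∀ x ∈ Set.Icc a b, inner ℝ (paramGradient relu heaviside θ x) δ = 0) :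
    inner ℝ (riskGradient a b f p relu heaviside θ) δ = 0 := by
  rw [inner_riskGradient hf hp, intervalIntegral.integral_congr (g := fun _ => 0)]
  · simp
  · intro x hx
    rw [Set.uIcc_of_le hab] at hx
    simp only [hδ x hx, mul_zero]

lemma IsInactiveAfter.innerWeight_riskGradient (hab : a ≤ b) (hf : Continuous f)
    (hp : Continuous p) {θ : Param (m + k)} (hθ : IsInactiveAfter a b m k θ) (j : Fin k) :
    innerWeight (riskGradient a b f p relu heaviside θ) (Fin.natAdd m j) = 0 := by
  have e : ∀ η : Param (m + k), inner ℝ η (innerWeightVec (Fin.natAdd m j))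
      = innerWeight η (Fin.natAdd m j) := fun η => by
    simp [innerWeightVec, innerWeight, EuclideanSpace.inner_single_right]
  rw [← e]
  refine inner_riskGradient_eq_zero hab hf hp fun x hx => ?_
  rw [e, paramGradient, innerWeight_mkParam, heaviside_of_nonpos (hθ.nonpos hx j)]
  simp

lemma IsInactiveAfter.innerBias_riskGradient (hab : a ≤ b) (hf : Continuous f)
    (hp : Continuous p) {θ : Param (m + k)} (hθ : IsInactiveAfter a b m k θ) (j : Fin k) :
    innerBias (riskGradient a b f p relu heaviside θ) (Fin.natAdd m j) = 0 := by
  have e : ∀ η : Param (m + k), inner ℝ η (innerBiasVec (Fin.natAdd m j))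
      = innerBias η (Fin.natAdd m j) := fun η => by
    simp [innerBiasVec, innerBias, EuclideanSpace.inner_single_right]
  rw [← e]
  refine inner_riskGradient_eq_zero hab hf hp fun x hx => ?_
  rw [e, paramGradient, innerBias_mkParam, heaviside_of_nonpos (hθ.nonpos hx j)]
  simp

/-- Inactive neurons do not move, so gradient descent reduces to the first `m` neurons. -/
lemma exists_isOpen_tendsto_risk_of_restrictParam (hab : a ≤ b) (hf : Continuous f)
    (hp : Continuous p) {γ : ℝ} {U : Set (Param m)} (hU : IsOpen U) (hne : U.Nonempty)
    (hconv : ∀ θ : ℕ → Param m, θ 0 ∈ U →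
      (∀ i, θ (i + 1) = θ i - γ • riskGradient a b f p relu heaviside (θ i)) →
      Tendsto (fun i => risk a b f p relu (θ i)) atTop (𝓝 0)) (k : ℕ) :
    ∃ W : Set (Param (m + k)), IsOpen W ∧ W.Nonempty ∧ ∀ θ : ℕ → Param (m + k), θ 0 ∈ W →
      (∀ i, θ (i + 1) = θ i - γ • riskGradient a b f p relu heaviside (θ i)) →
      Tendsto (fun i => risk a b f p relu (θ i)) atTop (𝓝 0) := by
  refine ⟨restrictParam m k ⁻¹' U ∩ {θ | IsInactiveAfter a b m k θ},
    (hU.preimage (restrictParam m k).continuous).inter isOpen_setOf_isInactiveAfter, ?_,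
    fun θ h0 hstep => ?_⟩
  · obtain ⟨η, hη⟩ := hne
    -- Surplus neurons with inner weight `0` and bias `-1` have constant preactivation `-1`.
    refine ⟨mkParam (Fin.append (innerWeight η) fun _ => 0) (Fin.append (innerBias η) fun _ => -1)
      (Fin.append (outerWeight η) fun _ => 0) (outerBias η), ?_, fun j => by simp⟩
    rw [Set.mem_preimage]
    convert hη using 1
    apply param_ext <;> simp
  -- Inactivity depends only on the inner parameters, and these are frozen as long as it holds.
  · have hin : ∀ i, IsInactiveAfter a b m k (θ i) := fun i => by
      induction i with
      | zero => exact h0.2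
      | succ i ih =>
        intro j
        rw [hstep]
        simp only [innerWeight_sub, innerBias_sub, innerWeight_smul, innerBias_smul,
          ih.innerWeight_riskGradient hab hf hp, ih.innerBias_riskGradient hab hf hp, mul_zero,
          sub_zero]
        exact ih j
    have := hconv (fun i => restrictParam m k (θ i)) h0.1 fun i => by
      rw [hstep, map_sub, map_smul, (hin i).riskGradient_restrictParam hab hf hp]
    simpa only [(hin _).risk_restrictParam hab] using this

end Restriction

/-! ### Gaussian initialization and independent trials. -/

/-- Lebesgue measure is absolutely continuous with respect to the one-dimensional Gaussian;
positivity on open sets passes to products and to images under continuous surjections. -/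
lemma stdGaussian_pos_of_isOpen {ι : Type*} [Fintype ι] {U : Set (EuclideanSpace ℝ ι)}
    (hU : IsOpen U) (hne : U.Nonempty) : 0 < stdGaussian (EuclideanSpace ℝ ι) U := by
  have : (gaussianReal 0 1).IsOpenPosMeasure :=
    (gaussianReal_absolutelyContinuous' 0 one_ne_zero).isOpenPosMeasure
  rw [← map_pi_eq_stdGaussian]
  have := (PiLp.continuous_toLp 2 (fun _ : ι => ℝ)).isOpenPosMeasure_map
    (WithLp.toLp_surjective 2) (μ := Measure.pi fun _ : ι => gaussianReal 0 1)
  exact hU.measure_pos _ hne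

/-- Among sufficiently many independent trials, one is successful. -/
lemma tendsto_measure_exists_mem {Ω E : Type*} [MeasurableSpace Ω] [MeasurableSpace E]
    {P : Measure Ω} [IsProbabilityMeasure P] {μ : Measure E} {X : ℕ → Ω → E}
    (hX : ∀ k, 1 ≤ k → Measurable (X k))
    (hindep : iIndepFun (fun k : {k : ℕ // 1 ≤ k} => X k) P) (hmap : ∀ k, 1 ≤ k → P.map (X k) = μ)
    {U : Set E} (hU : MeasurableSet U) (hpos : 0 < μ U) :
    Tendsto (fun K : ℕ => P {ω | ∃ k ∈ Set.Icc 1 K, X k ω ∈ U}) atTop (𝓝 1) := by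
  have hμ : IsProbabilityMeasure μ :=
    hmap 1 le_rfl ▸ Measure.isProbabilityMeasure_map (hX 1 le_rfl).aemeasurable
  have hlt : μ Uᶜ < 1 := by
    rw [prob_compl_eq_one_sub hU]
    exact ENNReal.sub_lt_self ENNReal.one_ne_top one_ne_zero hpos.ne'
  -- The complement is the event that all `K` independent trials miss `U`.
  have hev : ∀ K : ℕ, P {ω | ∃ k ∈ Set.Icc 1 K, X k ω ∈ U} = 1 - μ Uᶜ ^ K := fun K => by
    have h1 := hindep.measure_inter_preimage_eq_mul
      ((Finset.Icc 1 K).subtype fun k => 1 ≤ k) (sets := fun _ => Uᶜ) fun _ _ => hU.compl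
    have h2 : ∀ k ∈ (Finset.Icc 1 K).subtype (fun k => 1 ≤ k), P (X k ⁻¹' Uᶜ) = μ Uᶜ :=
      fun k _ => by rw [← hmap k k.2, Measure.map_apply (hX k k.2) hU.compl]
    have h3 : ((Finset.Icc 1 K).subtype fun k => 1 ≤ k).card = K := by
      rw [Finset.card_subtype, Finset.filter_true_of_mem fun k hk => (Finset.mem_Icc.1 hk).1]
      simp
    rw [Finset.prod_congr rfl h2, Finset.prod_const, h3] at h1
    rw [← h1, ← prob_compl_eq_one_sub]
    · congr 1
      ext ω
      simp
      grind
    · exact Finset.measurableSet_biInter _ fun k _ => hX k k.2 hU.compl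
  simp_rw [hev]
  simpa using ENNReal.Tendsto.sub tendsto_const_nhds
    (ENNReal.tendsto_pow_atTop_nhds_zero_of_lt_one hlt) (Or.inl ENNReal.one_ne_top)

/-- Allows `f` and `p` to be replaced by continuous extensions to the whole line. -/
lemma risk_congr {a b : ℝ} (hab : a ≤ b) {f f' p p' : ℝ → ℝ} (hf : Set.EqOn f f' (Set.Icc a b))
    (hp : Set.EqOn p p' (Set.Icc a b)) (σ : ℝ → ℝ) :
    risk (h := h) a b f p σ = risk a b f' p' σ := by
  funext θ
  refine intervalIntegral.integral_congr fun x hx => ?_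
  rw [Set.uIcc_of_le hab] at hx
  simp only [hf hx, hp hx]

end ShallowNet

/-! ### The main theorem. -/

open ShallowNet in
theorem theorem1p1
    -- the interval, the grid and the piecewise affine target function
    (a b : ℝ) (hab : a < b) (f : ℝ → ℝ) (hf : ContinuousOn f (Set.Icc a b))
    (N : ℕ) (grid : Fin (N + 1) → ℝ) (hgrid : StrictMono grid)
    (hgrid_first : grid 0 = a) (hgrid_last : grid (Fin.last N) = b)
    (haffine : ∀ i : Fin N, ∃ α β : ℝ,
      ∀ x ∈ Set.Icc (grid i.castSucc) (grid i.succ), f x = α * x + β)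
    -- the continuously differentiable approximations of the ReLU activation
    (A : ℕ → ℝ → ℝ) (hA_smooth : ∀ r, ContDiff ℝ 1 (A r))
    (hA_bound : ∀ x : ℝ, ∃ C : ℝ, ∀ r : ℕ, ∀ y ∈ Set.Icc (-|x|) |x|, |deriv (A r) y| ≤ C)
    (hA_lim : ∀ x : ℝ, Tendsto
      (fun r : ℕ => |A r x - ShallowNet.relu x|
        + |deriv (A r) x - Set.indicator (Set.Ioi (0 : ℝ)) (fun _ => (1 : ℝ)) x|)
      atTop (𝓝 0))
    -- the unnormalized density
    (p : ℝ → ℝ) (hp_pos : ∀ x ∈ Set.Icc a b, 0 < p x)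
    (hp_lip : ∃ L : ℝ≥0, LipschitzOnWith L p (Set.Icc a b))
    -- the generalized gradients
    (G : ∀ h : ℕ, ShallowNet.Param h → ShallowNet.Param h)
    (hG : ∀ h : ℕ, 1 ≤ h → ∀ θ l : ShallowNet.Param h,
      Tendsto (fun r : ℕ => gradient (ShallowNet.risk a b f p (A r)) θ) atTop (𝓝 l) → G h θ = l)
    -- gradient descent: `Θ h k γ n` is the `n`-th iterate with width `h`, step size `γ`,
    -- in the `k`-th run, and `κ h K γ n` is the best of the first `K` runs after `n` steps
    {Ω : Type*} [MeasurableSpace Ω] (P : Measure Ω) [IsProbabilityMeasure P]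
    (Θ : ∀ h : ℕ, ℕ → ℝ → ℕ → Ω → ShallowNet.Param h)
    (κ : ℕ → ℕ → ℝ → ℕ → Ω → ℕ)
    (hΘ_meas : ∀ h k : ℕ, 1 ≤ h → 1 ≤ k → ∀ (γ : ℝ) (n : ℕ), Measurable (Θ h k γ n))
    (hκ_meas : ∀ h k : ℕ, 1 ≤ h → 1 ≤ k → ∀ (γ : ℝ) (n : ℕ), Measurable (κ h k γ n))
    (hΘ_indep : ∀ h : ℕ, 1 ≤ h → ∀ γ : ℝ, iIndepFun (fun k : {k : ℕ // 1 ≤ k} => Θ h k γ 0) P)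
    (hΘ_normal : ∀ h k : ℕ, 1 ≤ h → 1 ≤ k → ∀ γ : ℝ,
      P.map (Θ h k γ 0) = stdGaussian (ShallowNet.Param h))
    (hΘ_step : ∀ h k : ℕ, 1 ≤ h → 1 ≤ k → ∀ (γ : ℝ) (n : ℕ) (ω : Ω),
      Θ h k γ (n + 1) ω = Θ h k γ n ω - γ • G h (Θ h k γ n ω))
    (hκ_argmin : ∀ h K : ℕ, 1 ≤ h → 1 ≤ K → ∀ (γ : ℝ) (n : ℕ) (ω : Ω),
      κ h K γ n ω ∈ Set.Icc 1 K ∧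
        ∀ l ∈ Set.Icc 1 K,
          ShallowNet.risk a b f p ShallowNet.relu (Θ h (κ h K γ n ω) γ n ω)
            ≤ ShallowNet.risk a b f p ShallowNet.relu (Θ h l γ n ω)) :
    ∃ g : ℝ, 0 < g ∧ ∀ γ : ℝ, 0 < γ → γ ≤ g →
      liminf (fun h : ℕ => liminf (fun K : ℕ =>
        P {ω | limsup (fun n : ℕ =>
          ((ShallowNet.risk a b f p ShallowNet.relu (Θ h (κ h K γ n ω) γ n ω) : ℝ) : EReal))
            atTop = 0}) atTop) atTop = 1 := by
  -- No cells would force `a = b`.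
  obtain _ | n := N
  · exact absurd (hgrid_first.symm.trans hgrid_last) hab.ne
  choose α β hαβ using haffine
  subst hgrid_first hgrid_last
  set a := grid 0
  set b := grid (Fin.last (n + 1))
  set f₁ := Set.IccExtend hab.le ((Set.Icc a b).domRestrict f) with hf₁
  set p₁ := Set.IccExtend hab.le ((Set.Icc a b).domRestrict p) with hp₁
  have hff : Set.EqOn f f₁ (Set.Icc a b) := fun x hx => by
    rw [hf₁, Set.IccExtend_of_mem _ _ hx]; rfl
  have hpp : Set.EqOn p p₁ (Set.Icc a b) := fun x hx => by
    rw [hp₁, Set.IccExtend_of_mem _ _ hx]; rfl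
  have hf₁c : Continuous f₁ := (continuousOn_iff_continuous_domRestrict.1 hf).Icc_extend'
  have hp₁c : Continuous p₁ := by
    obtain ⟨L, hL⟩ := hp_lip
    exact (continuousOn_iff_continuous_domRestrict.1 hL.continuousOn).Icc_extend'
  have hp₁pos : ∀ x ∈ Set.Icc a b, 0 < p₁ x := fun x hx => hpp hx ▸ hp_pos x hx
  have hmono := hgrid.monotone
  have H : IsPiecewiseAffine f₁ grid α β := ⟨hgrid, fun i x hx => by
    rw [← hff ⟨(hmono (Fin.zero_le _)).trans hx.1, hx.2.trans (hmono (Fin.le_last _))⟩]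
    exact hαβ i x hx⟩
  have hA : ∀ x, Tendsto (fun r => A r x) atTop (𝓝 (relu x)) := fun x =>
    tendsto_iff_norm_sub_tendsto_zero.2 (squeeze_zero (fun _ => norm_nonneg _)
      (fun r => le_add_of_nonneg_right (abs_nonneg _)) (hA_lim x))
  have hA' : ∀ x, Tendsto (fun r => deriv (A r) x) atTop (𝓝 (heaviside x)) := fun x =>
    tendsto_iff_norm_sub_tendsto_zero.2 (squeeze_zero (fun _ => norm_nonneg _)
      (fun r => le_add_of_nonneg_left (abs_nonneg _)) (hA_lim x))
  have hG' : ∀ h : ℕ, 1 ≤ h → ∀ θ : Param h, G h θ = riskGradient a b f₁ p₁ relu heaviside θ := by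
    refine fun h hh θ => hG h hh θ _ ?_
    have := tendsto_riskGradient hab.le hf₁c hp₁c hA_smooth hA_bound hA hA' θ
    refine this.congr fun r => ?_
    rw [risk_congr hab.le hff hpp, (hasGradientAt_risk hf₁c hp₁c (hA_smooth r) θ).gradient]
  obtain ⟨g, hg, hconv⟩ := H.exists_isOpen_tendsto_risk hf₁c hp₁c hp₁pos
  refine ⟨g, hg, fun γ hγ hγg => ?_⟩
  obtain ⟨U, hU, hUm, hUconv⟩ := hconv γ hγ hγg
  -- The inner limit inferior already equals `1` for every width `h ≥ n + 1`.
  refine Tendsto.liminf_eq (tendsto_const_nhds.congr' ?_)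
  filter_upwards [eventually_ge_atTop (n + 1)] with h hh
  have hh1 : 1 ≤ h := (Nat.le_add_left 1 n).trans hh
  obtain ⟨W, hWo, hWne, hWconv⟩ : ∃ W : Set (Param h), IsOpen W ∧ W.Nonempty ∧
      ∀ θ : ℕ → Param h, θ 0 ∈ W →
      (∀ i, θ (i + 1) = θ i - γ • riskGradient a b f₁ p₁ relu heaviside (θ i)) →
      Tendsto (fun i => risk a b f₁ p₁ relu (θ i)) atTop (𝓝 0) := by
    obtain ⟨k, rfl⟩ := Nat.exists_eq_add_of_le hh
    exact exists_isOpen_tendsto_risk_of_restrictParam hab.le hf₁c hp₁c hU ⟨_, hUm⟩ hUconv k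
  have hlim := tendsto_measure_exists_mem (fun k hk => hΘ_meas h k hh1 hk γ 0) (hΘ_indep h hh1 γ)
    (fun k hk => hΘ_normal h k hh1 hk γ) hWo.measurableSet (stdGaussian_pos_of_isOpen hWo hWne)
  refine (Tendsto.liminf_eq (tendsto_of_tendsto_of_tendsto_of_le_of_le' hlim tendsto_const_nhds
    ?_ (Eventually.of_forall fun _ => prob_le_one))).symm
  filter_upwards [eventually_ge_atTop 1] with K hK
  -- If one of the first `K` runs starts in `W`, the best risk is squeezed between `0` and the risk
  -- of that run, even though the best index may change with the iteration.
  refine measure_mono fun ω hω => ?_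
  obtain ⟨l, hl, hlW⟩ := hω
  have h1 : Tendsto (fun i => risk a b f p relu (Θ h l γ i ω)) atTop (𝓝 0) := by
    rw [risk_congr hab.le hff hpp]
    refine hWconv (fun i => Θ h l γ i ω) hlW fun i => ?_
    rw [hΘ_step h l hh1 hl.1, hG' h hh1]
  have h2 : Tendsto (fun i => risk a b f p relu (Θ h (κ h K γ i ω) γ i ω)) atTop (𝓝 0) :=
    squeeze_zero (fun i => risk_nonneg hab.le (fun x hx => (hp_pos x hx).le) _ _)
      (fun i => (hκ_argmin h K hh1 hK γ i ω).2 l hl) h1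
  exact ((continuous_coe_real_ereal.tendsto 0).comp h2).limsup_eq
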